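/- Let $d\ge 2$ be a fixed integer and let $\alpha>0$. There is a constant $c_5>0$, depending only on $\alpha$ and $d$, such that the following holds for every integer $n\ge 1$ and every real $\mu_n>0$ with $$n\binom{n-2}{d-2}\mu_n\;\ge\;\alpha\log n$$ (for $n=1$, $\binom{-1}{d-2}$ is read as $1$ if $d=2$ and as $0$ if $d>2$). Let $\mathcal E$ be the set of all $d$-element subsets of $[n]=\{1,\dots,n\}$, and let $(W_e)_{e\in\mathcal E}$ be independent random variables with values in $[0,1]$ and $\mathbb E[W_e]\le\mu_n$ for all $e\in\mathcal E$. Let $\mathbf A$ be the similarity matrix of the weighted $d$-uniform random hypergraph $([n],(W_e)_{e\in\mathcal E})$, that is, the $n\times n$ symmetric matrix with $\mathbf A_{ii}=0$ and $\mathbf A_{ij}=\sum_{e\in\mathcal E:\,\{i,j\}\subseteq e}W_e$ for $i\ne j$. Then, with probability at least $1-4n^{-11}$, $$\bigl\|\mathbf A-\mathbb E[\mathbf A]\bigr\|\;\le\;c_5\sqrt{n\binom{n-2}{d-2}\mu_n},$$ where $\|\cdot\|$ is the spectral norm and $\mathbb E[\mathbf A]$ is the entrywise expectation. -/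

import Mathlib

open MeasureTheory ProbabilityTheory

noncomputable section

namespace RandomHypergraph

/-- The edges of the complete `d`-uniform hypergraph on the vertex set `{0, …, n - 1}`:
all sets of exactly `d` vertices. -/
abbrev Edge (n d : ℕ) : Type := {e : Finset (Fin n) // e.card = d}

/-- The similarity matrix of the weighted `d`-uniform hypergraph with edge weights `w`: the
diagonal vanishes, and for `i ≠ j` the `(i, j)` entry is the total weight of the edges that
contain both `i` and `j`. -/
def similarityMatrix {n d : ℕ} (w : Edge n d → ℝ) : Matrix (Fin n) (Fin n) ℝ :=
  Matrix.of fun i j =>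
    if i = j then 0 else ∑ e : Edge n d, if i ∈ e.1 ∧ j ∈ e.1 then w e else 0

/-- The expectation of a random matrix, taken entry by entry. -/
def expectedMatrix {Ω : Type*} [MeasurableSpace Ω] {n : ℕ} (P : Measure Ω)
    (A : Ω → Matrix (Fin n) (Fin n) ℝ) : Matrix (Fin n) (Fin n) ℝ :=
  Matrix.of fun i j => ∫ ω, A ω i j ∂P

/-- The spectral norm of a square matrix: its operator norm with respect to the Euclidean
norm. -/
def matrixSpectralNorm {n : ℕ} (M : Matrix (Fin n) (Fin n) ℝ) : ℝ :=
  ‖Matrix.toEuclideanCLM (n := Fin n) (𝕜 := ℝ) M‖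

end RandomHypergraph

end

/-! The argument is the light/heavy decomposition of Kahn and Szemerédi. Put D = n·C(n-2, d-2)·μ and
w = √D. By `matrixSpectralNorm_le_of_net` it suffices to bound the quadratic form of A - E[A] at the
points y of a net of at most e^{18n} points. The entries of A are dependent because they share
edges, but every linear form in A is a linear form in the independent weights, with at most d² pairs
per edge (`sum_mul_similarityMatrix`). Hence `measureReal_chernoff` serves throughout, at the price
of factors d².

Pairs with |y_i y_j| ≤ w/n are light: their coefficients are so small that the deviation fails with
probability at most e^{-29n}, which beats the size of the net (`measureReal_light`). For heavy pairs
no cancellation is needed, and A and E[A] are bounded separately. For E[A] the entrywise bound w²/n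
is enough. For A, two events that do not depend on y are used: row sums are O(D), where D ≥ α log n
enters (`measureReal_degree`), and the weight between nested sets S ⊆ T is controlled by its mean
and by the entropy of T (`measureReal_discrepancy`).

On these events `heavy_sum_le` is deterministic. It cuts |y| into superlevel sets at powers of two;
these are nested, so the entropy of the larger one pays for the choice of both. For heights a ≥ b,
row sums handle a ≥ wb and discrepancy handles a < wb; the error terms are then summed as geometric
series or by the ℓ² mass of y. -/

namespace RandomHypergraph

/-! ### Counting pairs of vertices inside edges. -/

section Combinatorics

variable {n d : ℕ}

/-- The total weight that a function of ordered pairs of vertices gives to the pairs of distinct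
vertices inside an edge. -/
noncomputable def pairWeight (f : Fin n → Fin n → ℝ) (e : Edge n d) : ℝ :=
  ∑ i, ∑ j, if i ≠ j ∧ i ∈ e.1 ∧ j ∈ e.1 then f i j else 0

/-- Exchanging the sums over pairs and edges turns a form in dependent entries into one in
independent weights. -/
theorem sum_mul_similarityMatrix (w : Edge n d → ℝ) (f : Fin n → Fin n → ℝ) :
    ∑ i, ∑ j, f i j * similarityMatrix w i j = ∑ e, w e * pairWeight f e := by
  simp only [pairWeight, Finset.mul_sum]
  rw [eq_comm, Finset.sum_comm]
  refine Finset.sum_congr rfl fun i _ => ?_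
  rw [Finset.sum_comm]
  refine Finset.sum_congr rfl fun j _ => ?_
  simp only [similarityMatrix, Matrix.of_apply]
  by_cases hij : i = j
  · simp [hij]
  · simp only [hij, if_false, Finset.mul_sum, ne_eq, not_false_eq_true, true_and]
    refine Finset.sum_congr rfl fun e _ => ?_
    split_ifs <;> ring

/-- Erasing i and j is injective on these edges and lands in the (d-2)-subsets of the other
vertices. -/
theorem card_edges_containing_pair_le {i j : Fin n} (hij : i ≠ j) :
    (Finset.univ.filter fun e : Edge n d => i ∈ e.1 ∧ j ∈ e.1).card ≤
      (n - 2).choose (d - 2) := by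
  have hcard : (Finset.powersetCard (d - 2) ((Finset.univ.erase i).erase j)).card =
      (n - 2).choose (d - 2) := by
    rw [Finset.card_powersetCard, Finset.card_erase_of_mem (by simp [hij.symm]),
      Finset.card_erase_of_mem (Finset.mem_univ _), Finset.card_univ, Fintype.card_fin]
    rfl
  rw [← hcard]
  refine Finset.card_le_card_of_injOn (fun e => (e.1.erase i).erase j) ?_ ?_
  · intro e he
    simp only [Finset.coe_filter, Finset.mem_univ, true_and, Set.mem_ofPred_eq] at he
    simp only [Finset.mem_coe,
      Finset.mem_powersetCard]
    refine ⟨Finset.erase_subset_erase _ (Finset.erase_subset_erase _ (Finset.subset_univ _)), ?_⟩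
    rw [Finset.card_erase_of_mem (Finset.mem_erase.2 ⟨hij.symm, he.2⟩),
      Finset.card_erase_of_mem he.1, e.2]
    rfl
  · intro e he e' he' h
    simp only [Finset.coe_filter, Finset.mem_univ, true_and, Set.mem_ofPred_eq] at he he'
    apply Subtype.ext
    have := congrArg (fun s => insert i (insert j s)) h
    simpa [Finset.insert_erase, hij.symm, he.1, he.2, he'.1, he'.2] using this

theorem pairWeight_nonneg {f : Fin n → Fin n → ℝ} (hf : ∀ i j, 0 ≤ f i j) (e : Edge n d) :
    0 ≤ pairWeight f e :=
  Finset.sum_nonneg fun i _ => Finset.sum_nonneg fun j _ => by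
    split_ifs
    · exact hf i j
    · exact le_rfl

theorem sum_pairWeight_le {f : Fin n → Fin n → ℝ} (hf : ∀ i j, 0 ≤ f i j) :
    ∑ e : Edge n d, pairWeight f e ≤ ((n - 2).choose (d - 2) : ℝ) * ∑ i, ∑ j, f i j := by
  simp only [pairWeight, Finset.mul_sum]
  rw [Finset.sum_comm]
  refine Finset.sum_le_sum fun i _ => ?_
  rw [Finset.sum_comm]
  refine Finset.sum_le_sum fun j _ => ?_
  by_cases hij : i = j
  · simp only [hij, ne_eq, not_true_eq_false, false_and, if_false, Finset.sum_const_zero]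
    exact mul_nonneg (Nat.cast_nonneg _) (hf j j)
  · simp only [ne_eq, hij, not_false_eq_true, true_and]
    rw [← Finset.sum_filter, Finset.sum_const, nsmul_eq_mul]
    exact mul_le_mul_of_nonneg_right
      (Nat.cast_le.2 (card_edges_containing_pair_le hij)) (hf i j)

theorem pairWeight_eq_sum_edge (f : Fin n → Fin n → ℝ) (e : Edge n d) :
    pairWeight f e = ∑ p ∈ e.1 ×ˢ e.1, if p.1 ≠ p.2 then f p.1 p.2 else 0 := by
  rw [Finset.sum_product, pairWeight]
  rw [← Finset.sum_subset (Finset.subset_univ e.1)]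
  · refine Finset.sum_congr rfl fun i hi => ?_
    rw [← Finset.sum_subset (Finset.subset_univ e.1)]
    · exact Finset.sum_congr rfl fun j hj => by simp [hi, hj]
    · intro j _ hj
      simp [hj]
  · intro i _ hi
    simp [hi]

theorem abs_pairWeight_le {f : Fin n → Fin n → ℝ} {c : ℝ} (hc : 0 ≤ c)
    (hf : ∀ i j, |f i j| ≤ c) (e : Edge n d) : |pairWeight f e| ≤ (d : ℝ) ^ 2 * c := by
  rw [pairWeight_eq_sum_edge]
  calc _ ≤ ∑ p ∈ e.1 ×ˢ e.1, |if p.1 ≠ p.2 then f p.1 p.2 else 0| :=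
        Finset.abs_sum_le_sum_abs _ _
    _ ≤ ∑ p ∈ e.1 ×ˢ e.1, c := Finset.sum_le_sum fun p _ => by
        split_ifs
        · exact hf _ _
        · simpa using hc
    _ = (d : ℝ) ^ 2 * c := by
        rw [Finset.sum_const, Finset.card_product, e.2, nsmul_eq_mul]
        push_cast
        ring

/-- Cauchy–Schwarz over the d² ordered pairs of an edge, diagonal included; this controls the
variance of a light form. -/
theorem sq_pairWeight_le (f : Fin n → Fin n → ℝ) (e : Edge n d) :
    pairWeight f e ^ 2 ≤ (d : ℝ) ^ 2 * pairWeight (fun i j => f i j ^ 2) e := by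
  rw [pairWeight_eq_sum_edge, pairWeight_eq_sum_edge]
  refine (sq_sum_le_card_mul_sum_sq (s := e.1 ×ˢ e.1)).trans (le_of_eq ?_)
  rw [Finset.card_product, e.2]
  push_cast
  rw [sq (d : ℝ)]
  congr 1
  exact Finset.sum_congr rfl fun p _ => by split_ifs <;> simp

end Combinatorics

/-! ### Chernoff bounds for weights in the unit interval. -/

section Tail

variable {Ω ι : Type*} [MeasurableSpace Ω] [Fintype ι] {P : Measure Ω} [IsProbabilityMeasure P]

theorem integrable_of_ae_mem_Icc {X : Ω → ℝ} (hX : Measurable X)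
    (h01 : ∀ᵐ ω ∂P, X ω ∈ Set.Icc (0 : ℝ) 1) : Integrable X P :=
  Integrable.of_mem_Icc 0 1 hX.aemeasurable h01

/-- By convexity the exponential lies below its chord over the unit interval. -/
theorem exp_mul_le_of_mem_Icc (g : ℝ) {x : ℝ} (hx : x ∈ Set.Icc (0 : ℝ) 1) :
    Real.exp (g * x) ≤ 1 + x * (Real.exp g - 1) := by
  have h := convexOn_exp.2 (Set.mem_univ 0) (Set.mem_univ g) (sub_nonneg.2 hx.2) hx.1 (by ring)
  simp only [smul_eq_mul, mul_zero, zero_add, Real.exp_zero] at h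
  rw [mul_comm g x]
  linarith

theorem integrable_exp_mul_of_mem_Icc {X : Ω → ℝ} (hX : Measurable X)
    (h01 : ∀ᵐ ω ∂P, X ω ∈ Set.Icc (0 : ℝ) 1) (g : ℝ) :
    Integrable (fun ω => Real.exp (g * X ω)) P := by
  refine Integrable.of_mem_Icc 0 (1 + |Real.exp g - 1|) (by fun_prop) ?_
  filter_upwards [h01] with ω hω
  refine ⟨(Real.exp_pos _).le, (exp_mul_le_of_mem_Icc g hω).trans ?_⟩
  have h1 := mul_le_mul_of_nonneg_left (le_abs_self (Real.exp g - 1)) hω.1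
  have h2 := mul_le_mul_of_nonneg_right hω.2 (abs_nonneg (Real.exp g - 1))
  linarith

/-- The chord bound followed by 1 + x ≤ eˣ: the moment generating function is dominated by that of a
Poisson variable with the same mean. -/
theorem integral_exp_mul_le {X : Ω → ℝ} (hX : Measurable X)
    (h01 : ∀ᵐ ω ∂P, X ω ∈ Set.Icc (0 : ℝ) 1) (g : ℝ) :
    ∫ ω, Real.exp (g * X ω) ∂P ≤ Real.exp ((∫ ω, X ω ∂P) * (Real.exp g - 1)) := by
  have hi := integrable_of_ae_mem_Icc hX h01
  calc ∫ ω, Real.exp (g * X ω) ∂P ≤ ∫ ω, (1 + X ω * (Real.exp g - 1)) ∂P := by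
        refine integral_mono_ae (integrable_exp_mul_of_mem_Icc hX h01 g)
          ((integrable_const _).add (hi.mul_const _)) ?_
        filter_upwards [h01] with ω hω using exp_mul_le_of_mem_Icc g hω
    _ = (∫ ω, X ω ∂P) * (Real.exp g - 1) + 1 := by
        rw [integral_add (integrable_const _) (hi.mul_const _), integral_mul_const]
        simp [add_comm]
    _ ≤ _ := Real.add_one_le_exp _

/-- Chernoff's bound for a weighted sum of independent variables with values in `[0, 1]`. -/
theorem measureReal_chernoff {W : ι → Ω → ℝ} (hW : ∀ e, Measurable (W e))
    (h01 : ∀ e, ∀ᵐ ω ∂P, W e ω ∈ Set.Icc (0 : ℝ) 1) (hind : iIndepFun W P) (g : ι → ℝ) (τ : ℝ) :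
    P.real {ω | (∑ e, (∫ ω', W e ω' ∂P) * (Real.exp (g e) - 1)) + τ ≤ ∑ e, W e ω * g e} ≤
      Real.exp (-τ) := by
  set X : ι → Ω → ℝ := fun e ω => g e * W e ω with hXdef
  have hXm : ∀ e, Measurable (X e) := fun e => (hW e).const_mul _
  have hXi : iIndepFun X P :=
    hind.comp (fun e x => g e * x) fun e => measurable_const_mul _
  have hint : Integrable (fun ω => Real.exp (1 * (∑ e, X e) ω)) P :=
    hXi.integrable_exp_mul_sum hXm fun e _ => by
      simpa only [one_mul] using integrable_exp_mul_of_mem_Icc (hW e) (h01 e) (g e)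
  have hmgf : mgf (∑ e, X e) P 1 ≤
      Real.exp (∑ e, (∫ ω', W e ω' ∂P) * (Real.exp (g e) - 1)) := by
    rw [hXi.mgf_sum hXm, Real.exp_sum]
    refine Finset.prod_le_prod (fun e _ => mgf_nonneg) fun e _ => ?_
    simpa only [mgf, one_mul] using integral_exp_mul_le (hW e) (h01 e) (g e)
  have h := measure_ge_le_exp_mul_mgf
    ((∑ e, (∫ ω', W e ω' ∂P) * (Real.exp (g e) - 1)) + τ) zero_le_one hint
  have hset : {ω | (∑ e, (∫ ω', W e ω' ∂P) * (Real.exp (g e) - 1)) + τ ≤ ∑ e, W e ω * g e} =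
      {ω | (∑ e, (∫ ω', W e ω' ∂P) * (Real.exp (g e) - 1)) + τ ≤ (∑ e, X e) ω} := by
    ext ω
    simp [hXdef, mul_comm]
  rw [hset]
  refine h.trans ((mul_le_mul_of_nonneg_left hmgf (Real.exp_pos _).le).trans (le_of_eq ?_))
  rw [← Real.exp_add]
  congr 1
  ring

end Tail

/-! ### Block sums and entropy of vertex sets. -/

/-- The sum of the entries of a matrix over the rows in `S` and the columns in `T`. -/
def crossSum {n : ℕ} (A : Matrix (Fin n) (Fin n) ℝ) (S T : Finset (Fin n)) : ℝ :=
  ∑ i ∈ S, ∑ j ∈ T, A i j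

theorem crossSum_eq_sum_mul {n : ℕ} (A : Matrix (Fin n) (Fin n) ℝ) (S T : Finset (Fin n)) :
    crossSum A S T = ∑ i, ∑ j, (if i ∈ S ∧ j ∈ T then (1 : ℝ) else 0) * A i j := by
  have h : ∀ i, ∑ j, (if i ∈ S ∧ j ∈ T then (1 : ℝ) else 0) * A i j =
      if i ∈ S then ∑ j ∈ T, A i j else 0 := by
    intro i
    by_cases hi : i ∈ S <;> simp [hi]
  simp only [h, crossSum]
  simp

theorem sum_indicator_pair {n : ℕ} (S T : Finset (Fin n)) :
    ∑ i, ∑ j, (if i ∈ S ∧ j ∈ T then (1 : ℝ) else 0) = S.card * T.card := by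
  have h := (crossSum_eq_sum_mul (fun _ _ => (1 : ℝ)) S T).symm
  simpa [crossSum] using h

/-- The logarithm, up to a constant factor, of the number of pairs `S ⊆ T` with `t` elements
in `T`. -/
noncomputable def setEntropy (n t : ℕ) : ℝ := t * (1 + Real.log (n / t))

/-! ### High-probability events: discrepancy, degrees, light forms. -/

section

variable {n d : ℕ} {Ω : Type*} [MeasurableSpace Ω] {P : Measure Ω} [IsProbabilityMeasure P]
  {W : Edge n d → Ω → ℝ} {μ D : ℝ}

theorem expectedMatrix_similarityMatrix (hW : ∀ e, Measurable (W e))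
    (h01 : ∀ e, ∀ᵐ ω ∂P, W e ω ∈ Set.Icc (0 : ℝ) 1) :
    expectedMatrix P (fun ω => similarityMatrix (fun e => W e ω)) =
      similarityMatrix fun e => ∫ ω, W e ω ∂P := by
  ext i j
  simp only [expectedMatrix, similarityMatrix, Matrix.of_apply]
  by_cases hij : i = j
  · simp [hij]
  · simp only [hij, if_false]
    rw [integral_finsetSum]
    · refine Finset.sum_congr rfl fun e _ => ?_
      split_ifs <;> simp
    · intro e _
      split_ifs
      · exact integrable_of_ae_mem_Icc (hW e) (h01 e)
      · exact integrable_zero _ _ _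

/-- Nonnegative coefficients make the Chernoff exponent increasing in each mean, so every mean may
be replaced by μ. -/
theorem measureReal_chernoff_of_nonneg (hW : ∀ e, Measurable (W e))
    (h01 : ∀ e, ∀ᵐ ω ∂P, W e ω ∈ Set.Icc (0 : ℝ) 1) (hind : iIndepFun W P)
    (hμ : ∀ e, ∫ ω, W e ω ∂P ≤ μ) {g : Edge n d → ℝ} (hg : ∀ e, 0 ≤ g e) (τ : ℝ) :
    P.real {ω | μ * ∑ e, (Real.exp (g e) - 1) + τ ≤ ∑ e, W e ω * g e} ≤ Real.exp (-τ) := by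
  refine le_trans (measureReal_mono fun ω hω => ?_) (measureReal_chernoff hW h01 hind g τ)
  simp only [Set.mem_ofPred_eq] at hω ⊢
  refine le_trans ?_ hω
  rw [Finset.mul_sum]
  gcongr with e _
  · linarith [Real.one_le_exp (hg e)]
  · exact hμ e

/-- The total weight between two sets of vertices exceeds its mean by a large factor with small
probability. -/
theorem measureReal_crossSum_ge (hd : 2 ≤ d) (hn : 1 ≤ n) (hW : ∀ e, Measurable (W e))
    (h01 : ∀ e, ∀ᵐ ω ∂P, W e ω ∈ Set.Icc (0 : ℝ) 1) (hind : iIndepFun W P)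
    (hμ0 : 0 ≤ μ) (hμ : ∀ e, ∫ ω, W e ω ∂P ≤ μ)
    (hD : D = n * ((n - 2).choose (d - 2) : ℝ) * μ)
    (S T : Finset (Fin n)) {l : ℝ} (hl : 0 < l) (τ : ℝ) :
    P.real {ω | Real.exp l * (S.card * T.card) * (D / n) + d ^ 2 * τ / l ≤
      crossSum (similarityMatrix fun e => W e ω) S T} ≤ Real.exp (-τ) := by
  set f : Fin n → Fin n → ℝ := fun i j => if i ∈ S ∧ j ∈ T then 1 else 0 with hf
  have hd0 : (0 : ℝ) < (d : ℝ) ^ 2 := by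
    have : (0 : ℝ) < d := by exact_mod_cast (by omega : 0 < d)
    positivity
  have hn0 : (0 : ℝ) < n := by exact_mod_cast hn
  have hf0 : ∀ i j, 0 ≤ f i j := fun i j => by
    simp only [hf]; split_ifs <;> norm_num
  have hf1 : ∀ i j, |f i j| ≤ 1 := fun i j => by
    simp only [hf]; split_ifs <;> norm_num
  -- An edge meets at most d² pairs, so dividing by d² keeps the exponent at most l.
  set g : Edge n d → ℝ := fun e => l / d ^ 2 * pairWeight f e with hg
  have hg0 : ∀ e, 0 ≤ g e := fun e =>
    mul_nonneg (div_nonneg hl.le hd0.le) (pairWeight_nonneg hf0 e)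
  have hgl : ∀ e, g e ≤ l := fun e => by
    have h := (abs_le.1 (abs_pairWeight_le zero_le_one hf1 e)).2
    calc g e ≤ l / d ^ 2 * (d ^ 2 * 1) :=
          mul_le_mul_of_nonneg_left h (div_nonneg hl.le hd0.le)
      _ = l := by field_simp
  have hexp : ∀ e, Real.exp (g e) - 1 ≤ g e * Real.exp l := fun e => by
    have h1 : Real.exp (g e) - 1 ≤ g e * Real.exp (g e) := by
      have h2 := Real.add_one_le_exp (-(g e))
      have h3 : Real.exp (-(g e)) * Real.exp (g e) = 1 := by
        rw [← Real.exp_add]; simp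
      nlinarith [Real.exp_pos (g e)]
    exact h1.trans (mul_le_mul_of_nonneg_left (Real.exp_le_exp.2 (hgl e)) (hg0 e))
  have hsum : μ * ∑ e, (Real.exp (g e) - 1) ≤
      l / d ^ 2 * (Real.exp l * (S.card * T.card) * (D / n)) := by
    calc μ * ∑ e, (Real.exp (g e) - 1) ≤ μ * ∑ e, g e * Real.exp l := by
          gcongr with e _
          exact hexp e
      _ = μ * (l / d ^ 2) * Real.exp l * ∑ e : Edge n d, pairWeight f e := by
          rw [← Finset.sum_mul, ← Finset.mul_sum]; ring
      _ ≤ μ * (l / d ^ 2) * Real.exp l *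
          (((n - 2).choose (d - 2) : ℝ) * ∑ i, ∑ j, f i j) := by
          gcongr
          exact sum_pairWeight_le hf0
      _ = _ := by
          rw [sum_indicator_pair, hD]
          field_simp
  refine le_trans (measureReal_mono fun ω hω => ?_)
    (measureReal_chernoff_of_nonneg hW h01 hind hμ hg0 τ)
  simp only [Set.mem_ofPred_eq] at hω ⊢
  have hval : ∑ e, W e ω * g e =
      l / d ^ 2 * crossSum (similarityMatrix fun e => W e ω) S T := by
    rw [crossSum_eq_sum_mul, sum_mul_similarityMatrix, Finset.mul_sum]
    exact Finset.sum_congr rfl fun e _ => by simp only [hg, hf]; ring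
  rw [hval]
  have h := mul_le_mul_of_nonneg_left hω (div_nonneg hl.le hd0.le)
  have h2 : l / (d : ℝ) ^ 2 * (d ^ 2 * τ / l) = τ := by field_simp
  rw [mul_add, h2] at h
  linarith

/-- Exceeding some threshold means exceeding the smallest one, so the bound does not depend on the
size of Λ. -/
theorem measureReal_exists_crossSum_ge (hd : 2 ≤ d) (hn : 1 ≤ n) (hW : ∀ e, Measurable (W e))
    (h01 : ∀ e, ∀ᵐ ω ∂P, W e ω ∈ Set.Icc (0 : ℝ) 1) (hind : iIndepFun W P)
    (hμ0 : 0 ≤ μ) (hμ : ∀ e, ∫ ω, W e ω ∂P ≤ μ)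
    (hD : D = n * ((n - 2).choose (d - 2) : ℝ) * μ)
    (S T : Finset (Fin n)) {Λ : Finset ℝ} (hΛ : ∀ l ∈ Λ, 0 < l) (τ : ℝ) :
    P.real {ω | ∃ l ∈ Λ, Real.exp l * (S.card * T.card) * (D / n) + d ^ 2 * τ / l ≤
      crossSum (similarityMatrix fun e => W e ω) S T} ≤ Real.exp (-τ) := by
  rcases Λ.eq_empty_or_nonempty with rfl | hne
  · simpa using (Real.exp_pos _).le
  obtain ⟨l, hl, hmin⟩ := Λ.exists_min_image
    (fun l => Real.exp l * (S.card * T.card) * (D / n) + d ^ 2 * τ / l) hne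
  refine le_trans (measureReal_mono ?_)
    (measureReal_crossSum_ge hd hn hW h01 hind hμ0 hμ hD S T (hΛ l hl) τ)
  rintro ω ⟨l', hl', h⟩
  exact (hmin l' hl').trans h

/-- Split log n = log t + log(n/t) and use log t ≤ t - 1. -/
theorem log_le_setEntropy {t : ℕ} (hn : 1 ≤ n) (ht : 1 ≤ t) (htn : t ≤ n) :
    Real.log n ≤ setEntropy n t ∧ (t : ℝ) ≤ setEntropy n t := by
  have ht0 : (1 : ℝ) ≤ t := by exact_mod_cast ht
  have htn' : (t : ℝ) ≤ n := by exact_mod_cast htn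
  have hn0 : (0 : ℝ) < n := by linarith
  have hlog : 0 ≤ Real.log (n / t) := Real.log_nonneg (by rw [le_div_iff₀] <;> linarith)
  have h1 : Real.log n = Real.log t + Real.log (n / t) := by
    rw [Real.log_div (by positivity) (by positivity)]; ring
  have h2 := Real.log_le_sub_one_of_pos (by linarith : (0 : ℝ) < t)
  unfold setEntropy
  constructor <;> nlinarith

/-- The binomial coefficient is read off from a single term in the expansion of (t/n + 1)ⁿ ≤ eᵗ. -/
theorem choose_le_exp_setEntropy {t : ℕ} (hn : 1 ≤ n) (ht : 1 ≤ t) :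
    (n.choose t : ℝ) ≤ Real.exp (setEntropy n t) := by
  by_cases htn : t ≤ n
  swap
  · rw [Nat.choose_eq_zero_of_lt (by omega)]
    simpa using (Real.exp_pos _).le
  have ht0 : (0 : ℝ) < t := by exact_mod_cast ht
  have hn0 : (0 : ℝ) < n := by exact_mod_cast hn
  have h1 : ((t : ℝ) / n) ^ t * n.choose t ≤ (t / n + 1) ^ n := by
    rw [add_pow]
    have := Finset.single_le_sum
      (f := fun m => ((t : ℝ) / n) ^ m * 1 ^ (n - m) * n.choose m)
      (fun m _ => by positivity) (Finset.mem_range.2 (by omega : t < n + 1))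
    simpa using this
  have h2 : ((t : ℝ) / n + 1) ^ n ≤ Real.exp t := by
    calc ((t : ℝ) / n + 1) ^ n ≤ Real.exp (t / n) ^ n := by
          gcongr
          exact Real.add_one_le_exp _
      _ = Real.exp t := by
          rw [← Real.exp_nat_mul]
          congr 1
          field_simp
  have h3 : Real.exp (setEntropy n t) = Real.exp t * ((n : ℝ) / t) ^ t := by
    rw [setEntropy, mul_add, mul_one, Real.exp_add, Real.exp_nat_mul,
      Real.exp_log (by positivity)]
  rw [h3]
  have h4 : ((n : ℝ) / t) ^ t * ((t : ℝ) / n) ^ t = 1 := by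
    rw [← mul_pow]
    have : (n : ℝ) / t * (t / n) = 1 := by field_simp
    rw [this, one_pow]
  calc (n.choose t : ℝ) = ((n : ℝ) / t) ^ t * (((t : ℝ) / n) ^ t * n.choose t) := by
        rw [← mul_assoc, h4, one_mul]
    _ ≤ ((n : ℝ) / t) ^ t * Real.exp t := by
        gcongr
        exact h1.trans h2
    _ = _ := mul_comm _ _

theorem exp_neg_mul_log (hn : 1 ≤ n) (k : ℕ) :
    Real.exp (-(k * Real.log n)) = ((n : ℝ) ^ k)⁻¹ := by
  have hn0 : (0 : ℝ) < n := by exact_mod_cast hn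
  rw [Real.exp_neg, Real.exp_nat_mul, Real.exp_log hn0]

/-- Discrepancy: with high probability, all pairs of nested sets of vertices have controlled total
weight between them. -/
theorem measureReal_discrepancy (hd : 2 ≤ d) (hn : 1 ≤ n) (hW : ∀ e, Measurable (W e))
    (h01 : ∀ e, ∀ᵐ ω ∂P, W e ω ∈ Set.Icc (0 : ℝ) 1) (hind : iIndepFun W P)
    (hμ0 : 0 ≤ μ) (hμ : ∀ e, ∫ ω, W e ω ∂P ≤ μ)
    (hD : D = n * ((n - 2).choose (d - 2) : ℝ) * μ)
    {Λ : Finset ℝ} (hΛ : ∀ l ∈ Λ, 0 < l) :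
    P.real {ω | ∃ S T : Finset (Fin n), S ⊆ T ∧ T.Nonempty ∧ ∃ l ∈ Λ,
      Real.exp l * (S.card * T.card) * (D / n) + d ^ 2 * (14 * setEntropy n T.card) / l ≤
        crossSum (similarityMatrix fun e => W e ω) S T} ≤ ((n : ℝ) ^ 11)⁻¹ := by
  classical
  have hn0 : (0 : ℝ) < n := by exact_mod_cast hn
  set B : Finset (Fin n) → Finset (Fin n) → Set Ω := fun S T =>
    {ω | ∃ l ∈ Λ,
      Real.exp l * (S.card * T.card) * (D / n) + d ^ 2 * (14 * setEntropy n T.card) / l ≤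
        crossSum (similarityMatrix fun e => W e ω) S T} with hB
  -- Of the 14 units of entropy, one pays for the subsets S of T. Another will pay for the choice of
  -- T among sets of its size, and one log n for the choice of the size, which leaves 11.
  have hone : ∀ T : Finset (Fin n), T.Nonempty →
      P.real (⋃ S ∈ T.powerset, B S T) ≤ Real.exp (-(13 * setEntropy n T.card)) := by
    intro T hT
    have ht := log_le_setEntropy hn hT.card_pos (by simpa using T.card_le_univ)
    calc P.real (⋃ S ∈ T.powerset, B S T) ≤ ∑ S ∈ T.powerset, P.real (B S T) :=
          measureReal_biUnion_finset_le _ _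
      _ ≤ ∑ S ∈ T.powerset, Real.exp (-(14 * setEntropy n T.card)) :=
          Finset.sum_le_sum fun S _ =>
            measureReal_exists_crossSum_ge hd hn hW h01 hind hμ0 hμ hD S T hΛ _
      _ = 2 ^ T.card * Real.exp (-(14 * setEntropy n T.card)) := by
          rw [Finset.sum_const, Finset.card_powerset, nsmul_eq_mul]
          push_cast
          rfl
      _ ≤ Real.exp (setEntropy n T.card) * Real.exp (-(14 * setEntropy n T.card)) := by
          gcongr
          calc (2 : ℝ) ^ T.card ≤ Real.exp 1 ^ T.card := by
                gcongr
                linarith [Real.add_one_le_exp (1 : ℝ)]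
            _ = Real.exp T.card := by rw [← Real.exp_nat_mul, mul_one]
            _ ≤ _ := Real.exp_le_exp.2 ht.2
      _ = _ := by
          rw [← Real.exp_add]
          congr 1
          ring
  -- The empty set has entropy 0 and would contribute 1 to the union bound, so it is given weight 0.
  set φ : ℕ → ℝ := fun t => if t = 0 then 0 else Real.exp (-(13 * setEntropy n t)) with hφ
  calc _ ≤ P.real (⋃ T ∈ (Finset.univ : Finset (Fin n)).powerset,
        if T.Nonempty then ⋃ S ∈ T.powerset, B S T else ∅) := by
        refine measureReal_mono ?_ (measure_ne_top _ _)
        rintro ω ⟨S, T, hST, hT, h⟩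
        simp only [Set.mem_iUnion]
        refine ⟨T, by simp, ?_⟩
        rw [if_pos hT]
        simp only [Set.mem_iUnion]
        exact ⟨S, Finset.mem_powerset.2 hST, h⟩
    _ ≤ ∑ T ∈ (Finset.univ : Finset (Fin n)).powerset,
        P.real (if T.Nonempty then ⋃ S ∈ T.powerset, B S T else ∅) :=
        measureReal_biUnion_finset_le _ _
    _ ≤ ∑ T ∈ (Finset.univ : Finset (Fin n)).powerset, φ T.card := by
        refine Finset.sum_le_sum fun T _ => ?_
        by_cases hT : T.Nonempty
        · rw [if_pos hT]
          simp only [hφ, hT.card_pos.ne', if_false]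
          exact hone T hT
        · rw [if_neg hT]
          simp only [hφ, Finset.not_nonempty_iff_eq_empty.1 hT]
          simp
    _ = ∑ t ∈ Finset.range (n + 1), n.choose t • φ t := by
        rw [Finset.sum_powerset_apply_card, Finset.card_univ, Fintype.card_fin]
    _ = ∑ t ∈ Finset.range n, n.choose (t + 1) • φ (t + 1) := by
        rw [Finset.sum_range_succ']
        simp [hφ]
    _ ≤ ∑ t ∈ Finset.range n, Real.exp (-(12 * Real.log n)) := by
        refine Finset.sum_le_sum fun t ht => ?_
        have ht' := Finset.mem_range.1 ht
        have hlog := (log_le_setEntropy hn (Nat.succ_pos t) ht').1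
        have hch := choose_le_exp_setEntropy hn (Nat.succ_pos t)
        simp only [hφ, Nat.succ_ne_zero, if_false, nsmul_eq_mul]
        refine (mul_le_mul_of_nonneg_right hch (Real.exp_pos _).le).trans ?_
        rw [← Real.exp_add]
        refine Real.exp_le_exp.2 ?_
        simp only [Nat.succ_eq_add_one] at hlog ⊢
        linarith
    _ = ((n : ℝ) ^ 11)⁻¹ := by
        have h := exp_neg_mul_log hn 12
        push_cast at h
        rw [Finset.sum_const, Finset.card_range, nsmul_eq_mul, h]
        field_simp

theorem measureReal_degree (hd : 2 ≤ d) (hn : 1 ≤ n) (hW : ∀ e, Measurable (W e))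
    (h01 : ∀ e, ∀ᵐ ω ∂P, W e ω ∈ Set.Icc (0 : ℝ) 1) (hind : iIndepFun W P)
    (hμ0 : 0 ≤ μ) (hμ : ∀ e, ∫ ω, W e ω ∂P ≤ μ)
    (hD : D = n * ((n - 2).choose (d - 2) : ℝ) * μ) :
    P.real {ω | ∃ i : Fin n, Real.exp 1 * D + d ^ 2 * (12 * Real.log n) ≤
        crossSum (similarityMatrix fun e => W e ω) {i} Finset.univ} ≤ ((n : ℝ) ^ 11)⁻¹ := by
  have hn0 : (0 : ℝ) < n := by exact_mod_cast hn
  have hlog := exp_neg_mul_log hn 12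
  push_cast at hlog
  calc _ ≤ P.real (⋃ i ∈ (Finset.univ : Finset (Fin n)),
        {ω | Real.exp 1 * ((({i} : Finset (Fin n)).card : ℝ) *
          (Finset.univ : Finset (Fin n)).card) * (D / n) + d ^ 2 * (12 * Real.log n) / 1 ≤
          crossSum (similarityMatrix fun e => W e ω) {i} Finset.univ}) := by
        refine measureReal_mono ?_ (measure_ne_top _ _)
        rintro ω ⟨i, hi⟩
        simp only [Set.mem_iUnion]
        refine ⟨i, Finset.mem_univ _, ?_⟩
        simp only [Set.mem_ofPred_eq, Finset.card_singleton, Finset.card_univ, Fintype.card_fin]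
        refine le_trans (le_of_eq ?_) hi
        push_cast
        field_simp
    _ ≤ ∑ i ∈ (Finset.univ : Finset (Fin n)), Real.exp (-(12 * Real.log n)) :=
        (measureReal_biUnion_finset_le _ _).trans <| Finset.sum_le_sum fun i _ =>
          measureReal_crossSum_ge hd hn hW h01 hind hμ0 hμ hD {i} Finset.univ one_pos _
    _ = ((n : ℝ) ^ 11)⁻¹ := by
        rw [Finset.sum_const, Finset.card_univ, Fintype.card_fin, nsmul_eq_mul, hlog]
        field_simp

/-- A linear form of the centred similarity matrix with small coefficients is of the order of the
square root of the expected degree, up to exponentially small probability. -/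
theorem measureReal_light (hd : 2 ≤ d) (hn : 1 ≤ n) (hW : ∀ e, Measurable (W e))
    (h01 : ∀ e, ∀ᵐ ω ∂P, W e ω ∈ Set.Icc (0 : ℝ) 1) (hind : iIndepFun W P)
    (hμ0 : 0 ≤ μ) (hμ : ∀ e, ∫ ω, W e ω ∂P ≤ μ)
    (hD : D = n * ((n - 2).choose (d - 2) : ℝ) * μ) (hD0 : 0 < D)
    {f : Fin n → Fin n → ℝ} (hf : ∀ i j, |f i j| ≤ √D / n) (hf2 : ∑ i, ∑ j, f i j ^ 2 ≤ 1) :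
    P.real {ω | 30 * d ^ 2 * √D ≤ ∑ i, ∑ j, f i j *
      ((similarityMatrix fun e => W e ω) - similarityMatrix fun e => ∫ ω', W e ω' ∂P) i j} ≤
      Real.exp (-(29 * n)) := by
  have hd1 : (1 : ℝ) ≤ (d : ℝ) ^ 2 := by
    have : (1 : ℝ) ≤ d := by exact_mod_cast (by omega : 1 ≤ d)
    nlinarith
  have hn0 : (0 : ℝ) < n := by exact_mod_cast hn
  have hs : 0 < √D := Real.sqrt_pos.2 hD0
  have hss : √D ^ 2 = D := Real.sq_sqrt hD0.le
  -- The scale at which the bound d²√D/n on the pair weights becomes 1, so that eˣ - 1 - x ≤ x²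
  -- applies.
  set θ : ℝ := n / (d ^ 2 * √D) with hθ
  have hθ0 : 0 < θ := by positivity
  set g : Edge n d → ℝ := fun e => θ * pairWeight f e with hg
  have hg1 : ∀ e, |g e| ≤ 1 := fun e => by
    rw [hg, abs_mul, abs_of_pos hθ0]
    calc θ * |pairWeight f e| ≤ θ * (d ^ 2 * (√D / n)) := by
          gcongr
          exact abs_pairWeight_le (by positivity) hf e
      _ = 1 := by rw [hθ]; field_simp
  have hint0 : ∀ e, 0 ≤ ∫ ω, W e ω ∂P := fun e =>
    integral_nonneg_of_ae (by filter_upwards [h01 e] with ω hω using hω.1)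
  have hquad : μ * ∑ e, g e ^ 2 ≤ n := by
    calc μ * ∑ e, g e ^ 2 ≤ μ * ∑ e : Edge n d,
          θ ^ 2 * (d ^ 2 * pairWeight (fun i j => f i j ^ 2) e) := by
          gcongr with e _
          rw [hg, mul_pow]
          gcongr
          exact sq_pairWeight_le f e
      _ = μ * θ ^ 2 * d ^ 2 * ∑ e : Edge n d, pairWeight (fun i j => f i j ^ 2) e := by
          rw [← Finset.mul_sum, ← Finset.mul_sum]; ring
      _ ≤ μ * θ ^ 2 * d ^ 2 * (((n - 2).choose (d - 2) : ℝ) * 1) := by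
          gcongr
          refine (sum_pairWeight_le fun i j => sq_nonneg _).trans ?_
          gcongr
      _ = θ ^ 2 * d ^ 2 * (D / n) := by
          rw [hD]; field_simp
      _ = n / d ^ 2 := by
          rw [hθ]
          nth_rewrite 2 [← hss]
          field_simp
      _ ≤ n := div_le_self hn0.le hd1
  refine le_trans (measureReal_mono fun ω hω => ?_)
    (measureReal_chernoff hW h01 hind g (29 * n))
  simp only [Set.mem_ofPred_eq, Matrix.sub_apply, mul_sub, Finset.sum_sub_distrib,
    sum_mul_similarityMatrix] at hω
  simp only [Set.mem_ofPred_eq]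
  have h1 : ∑ e, (∫ ω', W e ω' ∂P) * (Real.exp (g e) - 1) ≤
      ∑ e, (∫ ω', W e ω' ∂P) * g e + μ * ∑ e, g e ^ 2 := by
    rw [Finset.mul_sum, ← Finset.sum_add_distrib]
    refine Finset.sum_le_sum fun e _ => ?_
    have h2 := (abs_le.1 (Real.abs_exp_sub_one_sub_id_le (hg1 e))).2
    have h3 := mul_le_mul_of_nonneg_left h2 (hint0 e)
    have h4 := mul_le_mul_of_nonneg_right (hμ e) (sq_nonneg (g e))
    linarith
  have h5 : ∀ w : Edge n d → ℝ, ∑ e, w e * g e = θ * ∑ e, w e * pairWeight f e := fun w => by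
    rw [Finset.mul_sum]
    exact Finset.sum_congr rfl fun e _ => by simp only [hg]; ring
  have h6 := mul_le_mul_of_nonneg_left hω hθ0.le
  -- The 30n splits into 29n for the tail and n for the quadratic term `hquad`.
  have h7 : θ * (30 * d ^ 2 * √D) = 30 * n := by rw [hθ]; field_simp
  rw [h5 fun e => ∫ ω', W e ω' ∂P] at h1
  rw [h5 fun e => W e ω]
  rw [h7, mul_sub] at h6
  linarith

end

/-! ### Geometric sums and comparison of entropies. -/

/-- The set F may have gaps, so the induction removes its least element, which carries the largest
term, and shrinks c by ρ. -/
theorem sum_le_of_geometric_decay {u : ℕ → ℝ} {ρ : ℝ} (hρ0 : 0 ≤ ρ) (hρ : ρ < 1)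
    (hu : ∀ k l, k < l → u l ≤ ρ * u k) (F : Finset ℕ) {c : ℝ} (hc : 0 ≤ c)
    (hF : ∀ k ∈ F, u k ≤ c) : ∑ k ∈ F, u k ≤ c / (1 - ρ) := by
  have h1 : 0 < 1 - ρ := by linarith
  induction F using Finset.induction_on_min generalizing c with
  | empty => simpa using div_nonneg hc h1.le
  | insert a s ha ih =>
    rw [Finset.sum_insert fun h => lt_irrefl _ (ha a h)]
    have hac := hF a (Finset.mem_insert_self _ _)
    have hs := ih (c := ρ * c) (mul_nonneg hρ0 hc) fun k hk =>
      (hu a k (ha k hk)).trans (mul_le_mul_of_nonneg_left hac hρ0)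
    calc u a + ∑ k ∈ s, u k ≤ c + ρ * c / (1 - ρ) := add_le_add hac hs
      _ = c / (1 - ρ) := by field_simp; ring

theorem sum_le_of_geometric_growth {u : ℕ → ℝ} {ρ : ℝ} (hρ0 : 0 ≤ ρ) (hρ : ρ < 1)
    (hu : ∀ k l, k < l → u k ≤ ρ * u l) (F : Finset ℕ) {c : ℝ} (hc : 0 ≤ c)
    (hF : ∀ k ∈ F, u k ≤ c) : ∑ k ∈ F, u k ≤ c / (1 - ρ) := by
  have h1 : 0 < 1 - ρ := by linarith
  induction F using Finset.induction_on_max generalizing c with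
  | empty => simpa using div_nonneg hc h1.le
  | insert a s ha ih =>
    rw [Finset.sum_insert fun h => lt_irrefl _ (ha a h)]
    have hac := hF a (Finset.mem_insert_self _ _)
    have hs := ih (c := ρ * c) (mul_nonneg hρ0 hc) fun k hk =>
      (hu k a (ha k hk)).trans (mul_le_mul_of_nonneg_left hac hρ0)
    calc u a + ∑ k ∈ s, u k ≤ c + ρ * c / (1 - ρ) := add_le_add hac hs
      _ = c / (1 - ρ) := by field_simp; ring

/-- Write n/t = (n/(tq²))·q² and bound the logarithm of the first factor by the factor itself. -/
theorem setEntropy_le {n t : ℕ} (hn : 1 ≤ n) (ht : 1 ≤ t) {q : ℝ} (hq : 1 ≤ q) :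
    setEntropy n t ≤ (1 + Real.log q) * (2 * t + n / q ^ 2) := by
  have ht0 : (0 : ℝ) < t := by exact_mod_cast ht
  have hn0 : (0 : ℝ) < n := by exact_mod_cast hn
  have hq0 : 0 < q := by linarith
  have hlq : 0 ≤ Real.log q := Real.log_nonneg hq
  have h1 : Real.log (n / t) = Real.log (n / t / q ^ 2) + 2 * Real.log q := by
    rw [Real.log_div (x := n / t) (y := q ^ 2) (by positivity) (by positivity), Real.log_pow]
    push_cast
    ring
  have h2 : Real.log (n / t / q ^ 2) ≤ n / t / q ^ 2 := by
    have := Real.log_le_sub_one_of_pos (by positivity : (0 : ℝ) < n / t / q ^ 2)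
    linarith
  have h3 : (t : ℝ) * (n / t / q ^ 2) = n / q ^ 2 := by field_simp
  have h4 := mul_le_mul_of_nonneg_left h2 ht0.le
  have h5 : 0 ≤ Real.log q * (n / q ^ 2) := by positivity
  rw [h3] at h4
  rw [setEntropy, h1]
  nlinarith

/-- With ζ = √(a/(wb)) and q = 4b²n one has r = qζ². Replacing log r by log q costs only a factor
2/ζ, while a = wbζ² supplies ζ²; the remaining ζ makes the sum over a converge. -/
theorem mul_setEntropy_div_le {n t : ℕ} (hn : 1 ≤ n) (ht : 1 ≤ t) {a b w : ℝ} (ha : 0 < a)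
    (hb : 0 < b) (hw : 0 < w) (haw : a < w * b) (hr : 1 ≤ 4 * (a * b) * n / w) :
    a * b * (setEntropy n t / (1 + Real.log (4 * (a * b) * n / w))) ≤
      2 * w * √(a / (w * b)) * (2 * (b ^ 2 * t) + (4 * b ^ 2 * n)⁻¹) ∧ 1 ≤ 4 * b ^ 2 * n := by
  have hn0 : (0 : ℝ) < n := by exact_mod_cast hn
  have ht0 : (0 : ℝ) < t := by exact_mod_cast ht
  set r := 4 * (a * b) * n / w with hrdef
  set q := 4 * b ^ 2 * n with hqdef
  set ζ := √(a / (w * b)) with hζ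
  have hζ0 : 0 < ζ := Real.sqrt_pos.2 (by positivity)
  have hζ2 : ζ ^ 2 = a / (w * b) := Real.sq_sqrt (by positivity)
  have hζ1 : ζ ≤ 1 := by
    rw [hζ, Real.sqrt_le_one]
    rw [div_le_one (by positivity)]
    exact haw.le
  have ha' : a = w * b * ζ ^ 2 := by rw [hζ2]; field_simp
  have hrq : r = q * ζ ^ 2 := by rw [hrdef, hqdef, hζ2]; field_simp
  have hq0 : 0 < q := by positivity
  have hq : 1 ≤ q := hr.trans (by rw [hrq]; exact mul_le_of_le_one_right hq0.le (by nlinarith))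
  refine ⟨?_, hq⟩
  have hlr : 0 ≤ Real.log r := Real.log_nonneg hr
  have hlogq : Real.log q = Real.log r + 2 * Real.log ζ⁻¹ := by
    rw [hrq, Real.log_mul hq0.ne' (by positivity), Real.log_pow, Real.log_inv]
    push_cast
    ring
  have hlz : 0 ≤ Real.log ζ⁻¹ := Real.log_nonneg ((one_le_inv₀ hζ0).2 hζ1)
  have hlz2 : Real.log ζ⁻¹ ≤ ζ⁻¹ - 1 := Real.log_le_sub_one_of_pos (by positivity)
  -- From log(1/ζ) ≤ 1/ζ - 1 and 1 + log r ≥ 1.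
  have hkey : 1 + Real.log q ≤ (1 + Real.log r) * (2 * ζ⁻¹) := by
    rw [hlogq]
    nlinarith
  have hmain : setEntropy n t / (1 + Real.log r) ≤ 2 * ζ⁻¹ * (2 * t + n / q ^ 2) := by
    rw [div_le_iff₀ (by linarith)]
    calc setEntropy n t ≤ (1 + Real.log q) * (2 * t + n / q ^ 2) := setEntropy_le hn ht hq
      _ ≤ (1 + Real.log r) * (2 * ζ⁻¹) * (2 * t + n / q ^ 2) := by gcongr
      _ = _ := by ring
  calc a * b * (setEntropy n t / (1 + Real.log r)) ≤
        a * b * (2 * ζ⁻¹ * (2 * t + n / q ^ 2)) := by gcongr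
    _ = 2 * w * ζ * (2 * (b ^ 2 * t) + b ^ 2 * n / q ^ 2) := by
        nth_rewrite 1 [ha']
        field_simp
    _ ≤ 2 * w * ζ * (2 * (b ^ 2 * t) + q⁻¹) := by
        gcongr
        rw [inv_eq_one_div, div_le_div_iff₀ (by positivity) hq0]
        rw [hqdef]
        have : 0 ≤ b ^ 4 * (n : ℝ) ^ 2 := by positivity
        nlinarith

/-! ### Heavy pairs: a deterministic bound by dyadic levels. -/

section Heavy

variable {n : ℕ}

/-- The indices of the entries of `x` that are at least `2⁻ᵏ`. -/
noncomputable def superlevel (x : Fin n → ℝ) (k : ℕ) : Finset (Fin n) :=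
  Finset.univ.filter fun i => (1 / 2 : ℝ) ^ k ≤ x i

theorem superlevel_mono (x : Fin n → ℝ) {k l : ℕ} (h : k ≤ l) :
    superlevel x k ⊆ superlevel x l := by
  intro i hi
  simp only [superlevel, Finset.mem_filter, Finset.mem_univ, true_and] at hi ⊢
  exact (pow_le_pow_of_le_one (by norm_num) (by norm_num) h).trans hi

theorem half_pow_lt_pow {k l : ℕ} (h : k < l) : (1 / 2 : ℝ) ^ l ≤ 1 / 2 * (1 / 2 : ℝ) ^ k := by
  rw [← pow_succ']
  exact pow_le_pow_of_le_one (by norm_num) (by norm_num) h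

/-- Each index i contributes a geometric series in 4⁻ᵏ whose largest term is at most x_i², hence at
most (4/3)x_i². -/
theorem sum_sq_mul_card_superlevel_le {x : Fin n → ℝ} (hx : ∑ i, x i ^ 2 ≤ 1) (L : ℕ) :
    ∑ k ∈ Finset.range L, ((1 / 2 : ℝ) ^ k) ^ 2 * (superlevel x k).card ≤ 2 := by
  have h1 : ∀ k, ((1 / 2 : ℝ) ^ k) ^ 2 * (superlevel x k).card =
      ∑ i, if (1 / 2 : ℝ) ^ k ≤ x i then ((1 / 2 : ℝ) ^ k) ^ 2 else 0 := by
    intro k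
    rw [← Finset.sum_filter, Finset.sum_const, nsmul_eq_mul, mul_comm]
    rfl
  simp only [h1]
  rw [Finset.sum_comm]
  calc _ ≤ ∑ i, 2 * x i ^ 2 := Finset.sum_le_sum fun i _ => by
        rw [← Finset.sum_filter]
        have h := sum_le_of_geometric_decay (u := fun k => ((1 / 2 : ℝ) ^ k) ^ 2) (ρ := 1 / 4)
          (by norm_num) (by norm_num) (fun k l hkl => by
            have := pow_le_pow_left₀ (by positivity) (half_pow_lt_pow hkl) 2
            rw [mul_pow] at this
            norm_num at this ⊢
            linarith)
          ((Finset.range L).filter fun k => (1 / 2 : ℝ) ^ k ≤ x i) (sq_nonneg (x i))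
          (fun k hk => pow_le_pow_left₀ (by positivity) (Finset.mem_filter.1 hk).2 2)
        refine h.trans ?_
        have := sq_nonneg (x i)
        rw [div_le_iff₀ (by norm_num)]
        linarith
    _ ≤ 2 := by rw [← Finset.mul_sum]; linarith

theorem exists_half_pow_near {y : ℝ} (hy : 0 < y) (hy1 : y ≤ 1) :
    ∃ k : ℕ, (1 / 2 : ℝ) ^ k ≤ y ∧ y ≤ 2 * (1 / 2 : ℝ) ^ k := by
  obtain ⟨m, hm1, hm2⟩ := exists_nat_pow_near_of_lt_one hy hy1
    (by norm_num : (0 : ℝ) < 1 / 2) (by norm_num)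
  refine ⟨m + 1, hm1.le, hm2.trans (le_of_eq ?_)⟩
  rw [pow_succ]
  ring

theorem le_one_of_sum_sq_le {x : Fin n → ℝ} (hx0 : ∀ i, 0 ≤ x i) (hx : ∑ i, x i ^ 2 ≤ 1)
    (i : Fin n) : x i ≤ 1 := by
  have h := Finset.single_le_sum (f := fun i => x i ^ 2) (fun i _ => sq_nonneg _)
    (Finset.mem_univ i)
  exact (sq_le_one_iff₀ (hx0 i)).1 (h.trans hx)

/-- Each entry is within a factor 2 of a power of two below it, and this single pair of levels
already dominates x_i x_j. As entries are at most 1, both factors of a heavy product exceed v, so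
levels from L on never occur. -/
theorem heavy_sum_le_sum_levels {A : Matrix (Fin n) (Fin n) ℝ} (hA : ∀ i j, 0 ≤ A i j)
    {x : Fin n → ℝ} (hx0 : ∀ i, 0 ≤ x i) (hx : ∑ i, x i ^ 2 ≤ 1) {v : ℝ} (hv : 0 < v) {L : ℕ}
    (hL : 2 * (1 / 2 : ℝ) ^ L ≤ v) :
    ∑ i, ∑ j, (if v < x i * x j then x i * x j else 0) * A i j ≤
      4 * ∑ k ∈ Finset.range L, ∑ l ∈ Finset.range L,
        if v ≤ 4 * ((1 / 2 : ℝ) ^ k * (1 / 2) ^ l) then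
          (1 / 2 : ℝ) ^ k * (1 / 2) ^ l * crossSum A (superlevel x k) (superlevel x l) else 0 := by
  have hx1 := le_one_of_sum_sq_le hx0 hx
  have hpt : ∀ i j, (if v < x i * x j then x i * x j else 0) ≤
      4 * ∑ k ∈ Finset.range L, ∑ l ∈ Finset.range L,
        if v ≤ 4 * ((1 / 2 : ℝ) ^ k * (1 / 2) ^ l) then (1 / 2 : ℝ) ^ k * (1 / 2) ^ l *
          (if i ∈ superlevel x k ∧ j ∈ superlevel x l then 1 else 0) else 0 := by
    intro i j
    have hterm : ∀ k l : ℕ, 0 ≤ if v ≤ 4 * ((1 / 2 : ℝ) ^ k * (1 / 2) ^ l) then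
        (1 / 2 : ℝ) ^ k * (1 / 2) ^ l *
          (if i ∈ superlevel x k ∧ j ∈ superlevel x l then 1 else 0) else 0 := fun k l => by
      split_ifs <;> positivity
    by_cases hij : v < x i * x j
    swap
    · rw [if_neg hij]
      exact mul_nonneg (by norm_num)
        (Finset.sum_nonneg fun k _ => Finset.sum_nonneg fun l _ => hterm k l)
    rw [if_pos hij]
    have hvi : v < x i := hij.trans_le (mul_le_of_le_one_right (hx0 i) (hx1 j))
    have hvj : v < x j := hij.trans_le (mul_le_of_le_one_left (hx0 j) (hx1 i))
    obtain ⟨k, hk1, hk2⟩ := exists_half_pow_near (hv.trans hvi) (hx1 i)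
    obtain ⟨l, hl1, hl2⟩ := exists_half_pow_near (hv.trans hvj) (hx1 j)
    have hlt : ∀ m : ℕ, v < 2 * (1 / 2 : ℝ) ^ m → m < L := fun m hm => by
      have h : (1 / 2 : ℝ) ^ L < (1 / 2) ^ m := by linarith
      exact (pow_lt_pow_iff_right_of_lt_one₀ (by norm_num) (by norm_num)).1 h
    have hxx : x i * x j ≤ 4 * ((1 / 2 : ℝ) ^ k * (1 / 2) ^ l) := by
      calc x i * x j ≤ (2 * (1 / 2 : ℝ) ^ k) * (2 * (1 / 2) ^ l) :=
            mul_le_mul hk2 hl2 (hx0 j) (by positivity)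
        _ = _ := by ring
    refine hxx.trans (mul_le_mul_of_nonneg_left ?_ (by norm_num))
    refine le_trans ?_ (Finset.single_le_sum (fun k _ => Finset.sum_nonneg fun l _ => hterm k l)
      (Finset.mem_range.2 (hlt k (hvi.trans_le hk2))))
    refine le_trans ?_ (Finset.single_le_sum (fun l _ => hterm k l)
      (Finset.mem_range.2 (hlt l (hvj.trans_le hl2))))
    rw [if_pos (hij.le.trans hxx), if_pos ⟨by simpa [superlevel] using hk1, by simpa [superlevel] using hl1⟩,
      mul_one]
  calc _ ≤ ∑ i, ∑ j, (4 * ∑ k ∈ Finset.range L, ∑ l ∈ Finset.range L,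
        if v ≤ 4 * ((1 / 2 : ℝ) ^ k * (1 / 2) ^ l) then (1 / 2 : ℝ) ^ k * (1 / 2) ^ l *
          (if i ∈ superlevel x k ∧ j ∈ superlevel x l then 1 else 0) else 0) * A i j := by
        gcongr with i _ j _
        · exact hA i j
        · exact hpt i j
    _ = _ := by
        simp only [mul_assoc, Finset.sum_mul, ← Finset.mul_sum]
        congr 1
        rw [Finset.sum_congr rfl fun i _ => Finset.sum_comm, Finset.sum_comm]
        refine Finset.sum_congr rfl fun k _ => ?_
        rw [Finset.sum_congr rfl fun i _ => Finset.sum_comm, Finset.sum_comm]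
        refine Finset.sum_congr rfl fun l _ => ?_
        split_ifs
        · rw [crossSum_eq_sum_mul]
          simp only [Finset.mul_sum, mul_assoc]
        · simp

theorem crossSum_comm {A : Matrix (Fin n) (Fin n) ℝ} (hA : ∀ i j, A i j = A j i)
    (S T : Finset (Fin n)) : crossSum A S T = crossSum A T S :=
  Finset.sum_comm.trans <|
    Finset.sum_congr rfl fun j _ => Finset.sum_congr rfl fun i _ => hA i j

theorem crossSum_nonneg {A : Matrix (Fin n) (Fin n) ℝ} (hA : ∀ i j, 0 ≤ A i j)
    (S T : Finset (Fin n)) : 0 ≤ crossSum A S T :=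
  Finset.sum_nonneg fun i _ => Finset.sum_nonneg fun j _ => hA i j

theorem crossSum_le_card_mul {A : Matrix (Fin n) (Fin n) ℝ} (hA : ∀ i j, 0 ≤ A i j) {B : ℝ}
    (hB : ∀ i, crossSum A {i} Finset.univ ≤ B) (S T : Finset (Fin n)) :
    crossSum A S T ≤ S.card * B := by
  rw [crossSum, ← nsmul_eq_mul]
  refine Finset.sum_le_card_nsmul _ _ _ fun i _ => le_trans ?_ (hB i)
  rw [crossSum, Finset.sum_singleton]
  exact Finset.sum_le_sum_of_subset_of_nonneg (Finset.subset_univ _) fun j _ _ => hA i j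

/-- Restricting to k ≤ l is what makes the two superlevel sets nested. -/
theorem sum_sum_le_two_mul_of_symm {G : ℕ → ℕ → ℝ} (hG : ∀ k l, 0 ≤ G k l)
    (hsymm : ∀ k l, G k l = G l k) (F : Finset ℕ) :
    ∑ k ∈ F, ∑ l ∈ F, G k l ≤ 2 * ∑ k ∈ F, ∑ l ∈ F, if k ≤ l then G k l else 0 := by
  have h : ∑ k ∈ F, ∑ l ∈ F, G k l ≤ ∑ k ∈ F, ∑ l ∈ F,
      ((if k ≤ l then G k l else 0) + if l ≤ k then G l k else 0) := by
    gcongr with k _ l _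
    rcases le_total k l with h | h
    · rw [if_pos h]
      have : 0 ≤ if l ≤ k then G l k else 0 := by split_ifs <;> simp [hG]
      linarith
    · rw [if_pos h, hsymm k l]
      have : 0 ≤ if k ≤ l then G l k else 0 := by split_ifs <;> simp [hG]
      linarith
  refine h.trans (le_of_eq ?_)
  simp only [Finset.sum_add_distrib]
  rw [two_mul]
  congr 1
  exact Finset.sum_comm

/-- Contribution of a pair of levels of a vector to its quadratic form, when the matrix has
bounded row sums and satisfies the discrepancy property. -/
theorem level_pair_le (hn : 1 ≤ n) {w : ℝ} (hw : 0 < w) {A : Matrix (Fin n) (Fin n) ℝ}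
    (hA : ∀ i j, 0 ≤ A i j) {C K : ℝ} (hC : 0 ≤ C) (hK : 0 ≤ K)
    (hdeg : ∀ i, crossSum A {i} Finset.univ ≤ C * w ^ 2)
    {S T : Finset (Fin n)} {a b : ℝ} (ha : 0 < a) (hb : 0 < b)
    (hr : 1 ≤ 4 * (a * b) * n / w)
    (hdisc : T.Nonempty → crossSum A S T ≤
      Real.exp (1 + Real.log (4 * (a * b) * n / w)) * (S.card * T.card) * (w ^ 2 / n) +
        K * (setEntropy n T.card / (1 + Real.log (4 * (a * b) * n / w)))) :
    a * b * crossSum A S T ≤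
      C * w ^ 2 * (a * S.card) * (if w * b ≤ a then b else 0) +
      12 * w * ((a ^ 2 * S.card) * (b ^ 2 * T.card)) +
      2 * K * w * ((if a < w * b then √(a / (w * b)) else 0) *
        (2 * (b ^ 2 * T.card) + if 1 ≤ 4 * b ^ 2 * n then (4 * b ^ 2 * n)⁻¹ else 0)) := by
  have hn0 : (0 : ℝ) < n := by exact_mod_cast hn
  have h2 : 0 ≤ 12 * w * ((a ^ 2 * S.card) * (b ^ 2 * T.card)) := by positivity
  have h3 : 0 ≤ 2 * K * w * ((if a < w * b then √(a / (w * b)) else 0) *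
      (2 * (b ^ 2 * T.card) + if 1 ≤ 4 * b ^ 2 * n then (4 * b ^ 2 * n)⁻¹ else 0)) := by
    split_ifs <;> positivity
  rcases le_or_gt (w * b) a with hab | hab
  · rw [if_pos hab]
    have h := crossSum_le_card_mul hA hdeg S T
    have h1 : a * b * crossSum A S T ≤ C * w ^ 2 * (a * S.card) * b := by
      calc a * b * crossSum A S T ≤ a * b * (S.card * (C * w ^ 2)) := by gcongr
        _ = _ := by ring
    linarith
  have h1 : 0 ≤ C * w ^ 2 * (a * S.card) * (if w * b ≤ a then b else 0) := by
    split_ifs <;> positivity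
  rcases T.eq_empty_or_nonempty with rfl | hT
  · have : crossSum A S ∅ = 0 := by simp [crossSum]
    rw [this, mul_zero]
    linarith
  obtain ⟨he, hq⟩ := mul_setEntropy_div_le hn hT.card_pos ha hb hw hab hr
  rw [if_pos hab, if_pos hq]
  have hexp : Real.exp (1 + Real.log (4 * (a * b) * n / w)) ≤ 3 * (4 * (a * b) * n / w) := by
    rw [Real.exp_add, Real.exp_log (by linarith)]
    gcongr
    linarith [Real.exp_one_lt_d9]
  have hmul := mul_le_mul_of_nonneg_left (hdisc hT) (by positivity : 0 ≤ a * b)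
  -- The exponent l = 1 + log r gives eˡ = e·r < 3r, which turns the mean term into a product of two
  -- ℓ² masses.
  have h4 : a * b * (Real.exp (1 + Real.log (4 * (a * b) * n / w)) * (S.card * T.card) *
      (w ^ 2 / n)) ≤ 12 * w * ((a ^ 2 * S.card) * (b ^ 2 * T.card)) := by
    calc _ ≤ a * b * (3 * (4 * (a * b) * n / w) * (S.card * T.card) * (w ^ 2 / n)) := by gcongr
      _ = _ := by field_simp; ring
  have h5 := mul_le_mul_of_nonneg_left he hK
  have h6 : K * (2 * w * √(a / (w * b)) * (2 * (b ^ 2 * T.card) + (4 * b ^ 2 * n)⁻¹)) =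
      2 * K * w * (√(a / (w * b)) * (2 * (b ^ 2 * T.card) + (4 * b ^ 2 * n)⁻¹)) := by ring
  linarith

theorem sum_level_bounds_le {C K w : ℝ} (hC : 0 ≤ C) (hK : 0 ≤ K) (hw : 0 < w) {R : Finset ℕ}
    {a s V : ℕ → ℝ} {U Z : ℕ → ℕ → ℝ} (ha0 : ∀ k, 0 < a k) (hs0 : ∀ k, 0 ≤ s k)
    (hV0 : ∀ l, 0 ≤ V l) (hM2 : ∑ k ∈ R, a k ^ 2 * s k ≤ 2)
    (hUsum : ∀ k, ∑ l ∈ R, U k l ≤ 2 * (a k / w)) (hVsum : ∑ l ∈ R, V l ≤ 2)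
    (hZsum : ∀ l, ∑ k ∈ R, Z k l ≤ 4) :
    ∑ k ∈ R, ∑ l ∈ R, (C * w ^ 2 * (a k * s k) * U k l +
      12 * w * ((a k ^ 2 * s k) * (a l ^ 2 * s l)) +
        2 * K * w * (Z k l * (2 * (a l ^ 2 * s l) + V l))) ≤
      4 * C * w + 48 * w + 48 * K * w := by
  generalize hM : ∑ k ∈ R, a k ^ 2 * s k = M at hM2
  have hM0 : 0 ≤ M := hM ▸ Finset.sum_nonneg fun k _ => mul_nonneg (sq_nonneg _) (hs0 k)
  have hsum1 : ∑ k ∈ R, ∑ l ∈ R, C * w ^ 2 * (a k * s k) * U k l ≤ 4 * C * w := by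
    calc _ = ∑ k ∈ R, C * w ^ 2 * (a k * s k) * ∑ l ∈ R, U k l := by
          simp only [Finset.mul_sum]
      _ ≤ ∑ k ∈ R, C * w ^ 2 * (a k * s k) * (2 * (a k / w)) := by
          refine Finset.sum_le_sum fun k _ => mul_le_mul_of_nonneg_left (hUsum k) ?_
          exact mul_nonneg (by positivity) (mul_nonneg (ha0 k).le (hs0 k))
      _ = 2 * C * w * M := by
          rw [← hM, Finset.mul_sum]
          exact Finset.sum_congr rfl fun k _ => by field_simp
      _ ≤ 2 * C * w * 2 := by gcongr
      _ = _ := by ring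
  have hsum2 : ∑ k ∈ R, ∑ l ∈ R, 12 * w * ((a k ^ 2 * s k) * (a l ^ 2 * s l)) ≤ 48 * w := by
    calc _ = 12 * w * (M * M) := by
          rw [← hM, Finset.sum_mul_sum]
          simp only [Finset.mul_sum]
      _ ≤ 12 * w * (2 * 2) := by gcongr
      _ = _ := by ring
  have hsum3 : ∑ k ∈ R, ∑ l ∈ R, 2 * K * w * (Z k l * (2 * (a l ^ 2 * s l) + V l)) ≤
      48 * K * w := by
    calc _ = 2 * K * w * ∑ l ∈ R, (∑ k ∈ R, Z k l) * (2 * (a l ^ 2 * s l) + V l) := by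
          rw [Finset.sum_comm]
          simp only [Finset.mul_sum, Finset.sum_mul]
      _ ≤ 2 * K * w * ∑ l ∈ R, 4 * (2 * (a l ^ 2 * s l) + V l) := by
          gcongr with l _
          · exact add_nonneg (mul_nonneg (by norm_num) (mul_nonneg (sq_nonneg _) (hs0 l))) (hV0 l)
          · exact hZsum l
      _ = 2 * K * w * (4 * (2 * M + ∑ l ∈ R, V l)) := by
          rw [← hM]
          simp only [Finset.mul_sum, Finset.sum_add_distrib, mul_add]
      _ ≤ 2 * K * w * (4 * (2 * 2 + 2)) := by gcongr
      _ = _ := by ring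
  simp only [Finset.sum_add_distrib]
  exact add_le_add (add_le_add hsum1 hsum2) hsum3

/-- The large entries of `x xᵀ` contribute `O(w)` to the quadratic form of a nonnegative matrix
with row sums `O(w²)` that satisfies the discrepancy property. -/
theorem heavy_sum_le (hn : 1 ≤ n) {w : ℝ} (hw : 0 < w) {A : Matrix (Fin n) (Fin n) ℝ}
    (hA : ∀ i j, 0 ≤ A i j) (hsymm : ∀ i j, A i j = A j i) {C K : ℝ} (hC : 0 ≤ C) (hK : 0 ≤ K)
    (hdeg : ∀ i, crossSum A {i} Finset.univ ≤ C * w ^ 2)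
    {L : ℕ} (hL : 2 * (1 / 2 : ℝ) ^ L ≤ w / n)
    (hdisc : ∀ S T : Finset (Fin n), S ⊆ T → T.Nonempty → ∀ k < L, ∀ l < L,
      1 ≤ 4 * ((1 / 2 : ℝ) ^ k * (1 / 2) ^ l) * n / w → crossSum A S T ≤
      Real.exp (1 + Real.log (4 * ((1 / 2 : ℝ) ^ k * (1 / 2) ^ l) * n / w)) *
        (S.card * T.card) * (w ^ 2 / n) +
        K * (setEntropy n T.card / (1 + Real.log (4 * ((1 / 2 : ℝ) ^ k * (1 / 2) ^ l) * n / w))))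
    {x : Fin n → ℝ} (hx0 : ∀ i, 0 ≤ x i) (hx : ∑ i, x i ^ 2 ≤ 1) :
    ∑ i, ∑ j, (if w / n < x i * x j then x i * x j else 0) * A i j ≤
      (32 * C + 384 + 384 * K) * w := by
  have hn0 : (0 : ℝ) < n := by exact_mod_cast hn
  set a : ℕ → ℝ := fun k => (1 / 2 : ℝ) ^ k with ha
  have ha0 : ∀ k, 0 < a k := fun k => by positivity
  set s : ℕ → ℝ := fun k => ((superlevel x k).card : ℝ) with hs
  have hs0 : ∀ k, 0 ≤ s k := fun k => Nat.cast_nonneg _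
  set R := Finset.range L with hR
  have hM2 : ∑ k ∈ R, a k ^ 2 * s k ≤ 2 := sum_sq_mul_card_superlevel_le hx L
  set U : ℕ → ℕ → ℝ := fun k l => if w * a l ≤ a k then a l else 0 with hU
  set Z : ℕ → ℕ → ℝ := fun k l => if a k < w * a l then √(a k / (w * a l)) else 0 with hZ
  set V : ℕ → ℝ := fun l => if 1 ≤ 4 * a l ^ 2 * n then (4 * a l ^ 2 * n)⁻¹ else 0 with hV
  have hU0 : ∀ k l, 0 ≤ U k l := fun k l => by
    simp only [hU]; split_ifs <;> first | exact (ha0 l).le | exact le_rfl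
  have hZ0 : ∀ k l, 0 ≤ Z k l := fun k l => by
    simp only [hZ]; split_ifs <;> positivity
  have hV0 : ∀ l, 0 ≤ V l := fun l => by
    simp only [hV]; split_ifs <;> positivity
  have hUsum : ∀ k, ∑ l ∈ R, U k l ≤ 2 * (a k / w) := fun k => by
    simp only [hU]
    rw [← Finset.sum_filter]
    refine (sum_le_of_geometric_decay (u := a) (ρ := 1 / 2) (by norm_num) (by norm_num)
      (fun k l h => half_pow_lt_pow h) _ (c := a k / w) (div_pos (ha0 k) hw).le ?_).trans
      (le_of_eq (by ring))
    intro l hl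
    rw [le_div_iff₀ hw, mul_comm]
    exact (Finset.mem_filter.1 hl).2
  have hVsum : ∑ l ∈ R, V l ≤ 2 := by
    simp only [hV]
    rw [← Finset.sum_filter]
    refine (sum_le_of_geometric_growth (u := fun l => (4 * a l ^ 2 * n)⁻¹) (ρ := 1 / 2)
      (by norm_num) (by norm_num) ?_ _ (c := 1) zero_le_one ?_).trans (by norm_num)
    · intro k l hkl
      have h := half_pow_lt_pow hkl
      have hk := ha0 k
      have hl := ha0 l
      have h' : a l ≤ 1 / 2 * a k := h
      have h2 : a l ^ 2 ≤ 1 / 2 * a k ^ 2 := by nlinarith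
      have h3 : (1 / 2 : ℝ) * (4 * a l ^ 2 * n)⁻¹ = (2 * (4 * a l ^ 2 * n))⁻¹ := by
        rw [mul_inv 2]; norm_num
      rw [h3]
      refine inv_anti₀ (by positivity) ?_
      nlinarith
    · intro l hl
      exact inv_le_one_of_one_le₀ (Finset.mem_filter.1 hl).2
  have hZsum : ∀ l, ∑ k ∈ R, Z k l ≤ 4 := fun l => by
    simp only [hZ]
    rw [← Finset.sum_filter]
    -- The true ratio is √(1/2); 3/4 is a rational upper bound.
    refine (sum_le_of_geometric_decay (u := fun k => √(a k / (w * a l))) (ρ := 3 / 4)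
      (by norm_num) (by norm_num) ?_ _ (c := 1) zero_le_one ?_).trans (by norm_num)
    · intro k m hkm
      have h' : a m ≤ 1 / 2 * a k := half_pow_lt_pow hkm
      have hk := ha0 k
      have hl := ha0 l
      rw [Real.sqrt_le_left (by positivity), mul_pow, Real.sq_sqrt (by positivity), ← mul_div_assoc]
      gcongr
      linarith
    · intro k hk
      have hl := ha0 l
      rw [Real.sqrt_le_one, div_le_one (by positivity)]
      exact (Finset.mem_filter.1 hk).2.le
  set G : ℕ → ℕ → ℝ := fun k l => if w / n ≤ 4 * (a k * a l) then
    a k * a l * crossSum A (superlevel x k) (superlevel x l) else 0 with hG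
  have hG0 : ∀ k l, 0 ≤ G k l := fun k l => by
    simp only [hG]
    split_ifs
    · exact mul_nonneg (mul_pos (ha0 k) (ha0 l)).le (crossSum_nonneg hA _ _)
    · exact le_rfl
  have hGs : ∀ k l, G k l = G l k := fun k l => by
    simp only [hG]
    rw [mul_comm (a k), crossSum_comm hsymm]
  have hterm : ∀ k ∈ R, ∀ l ∈ R, (if k ≤ l then G k l else 0) ≤
      C * w ^ 2 * (a k * s k) * U k l + 12 * w * ((a k ^ 2 * s k) * (a l ^ 2 * s l)) +
        2 * K * w * (Z k l * (2 * (a l ^ 2 * s l) + V l)) := by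
    intro k hk l hl
    have hnn : 0 ≤ C * w ^ 2 * (a k * s k) * U k l + 12 * w * ((a k ^ 2 * s k) * (a l ^ 2 * s l)) +
        2 * K * w * (Z k l * (2 * (a l ^ 2 * s l) + V l)) := by
      have h1 := hU0 k l
      have h2 := hZ0 k l
      have h3 := hV0 l
      have h4 := hs0 k
      have h5 := hs0 l
      have h6 := (ha0 k).le
      positivity
    by_cases hkl : k ≤ l
    swap
    · rwa [if_neg hkl]
    rw [if_pos hkl]
    simp only [hG]
    by_cases hv : w / n ≤ 4 * (a k * a l)
    swap
    · rwa [if_neg hv]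
    rw [if_pos hv]
    have hr : 1 ≤ 4 * (a k * a l) * n / w := by
      rw [le_div_iff₀ hw, one_mul]
      exact (div_le_iff₀ hn0).1 hv
    exact level_pair_le hn hw hA hC hK hdeg (ha0 k) (ha0 l) hr fun hT =>
      hdisc _ _ (superlevel_mono x hkl) hT k (Finset.mem_range.1 hk) l (Finset.mem_range.1 hl) hr
  calc _ ≤ 4 * ∑ k ∈ R, ∑ l ∈ R, G k l :=
        heavy_sum_le_sum_levels hA hx0 hx (div_pos hw hn0) hL
    _ ≤ 4 * (2 * ∑ k ∈ R, ∑ l ∈ R, if k ≤ l then G k l else 0) := by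
        gcongr
        exact sum_sum_le_two_mul_of_symm hG0 hGs R
    _ ≤ 4 * (2 * ∑ k ∈ R, ∑ l ∈ R, (C * w ^ 2 * (a k * s k) * U k l +
        12 * w * ((a k ^ 2 * s k) * (a l ^ 2 * s l)) +
          2 * K * w * (Z k l * (2 * (a l ^ 2 * s l) + V l)))) := by
        gcongr with k hk l hl
        exact hterm k hk l hl
    _ ≤ 4 * (2 * (4 * C * w + 48 * w + 48 * K * w)) := by
        gcongr
        exact sum_level_bounds_le hC hK hw ha0 hs0 hV0 hM2 hUsum hVsum hZsum
    _ = _ := by ring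

end Heavy

/-! ### A lattice net of the unit ball. -/

section Net

variable {n : ℕ}

/-- The integer vectors whose quotients by `4 √n` lie in the Euclidean unit ball. -/
noncomputable def latticeNet (n : ℕ) : Finset (Fin n → ℤ) :=
  (Fintype.piFinset fun _ => Finset.Icc (-(16 * n : ℤ)) (16 * n)).filter
    fun k => ∑ i, k i ^ 2 ≤ 16 * n

/-- The box only ensures finiteness: an integer satisfies |k| ≤ k², so the ball condition implies
it. -/
theorem mem_latticeNet {k : Fin n → ℤ} : k ∈ latticeNet n ↔ ∑ i, k i ^ 2 ≤ 16 * n := by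
  simp only [latticeNet, Finset.mem_filter, Fintype.mem_piFinset, Finset.mem_Icc,
    and_iff_right_iff_imp]
  intro h i
  have h1 := Finset.single_le_sum (f := fun i => k i ^ 2) (fun i _ => sq_nonneg _)
    (Finset.mem_univ i)
  have h2 : |k i| ≤ k i ^ 2 := by
    rw [← sq_abs, sq]
    rcases (abs_nonneg (k i)).eq_or_lt with h0 | h0
    · rw [← h0]; norm_num
    · exact le_mul_of_one_le_left h0.le h0
  exact abs_le.1 ((h2.trans h1).trans h)

theorem sum_half_pow_natAbs_le (R : ℕ) :
    ∑ k ∈ Finset.Icc (-(R : ℤ)) R, (1 / 2 : ℝ) ^ k.natAbs ≤ 3 - 2 * (1 / 2 : ℝ) ^ R := by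
  induction R with
  | zero => norm_num
  | succ R ih =>
    have h : Finset.Icc (-((R + 1 : ℕ) : ℤ)) ((R + 1 : ℕ) : ℤ) =
        insert (-((R + 1 : ℕ) : ℤ)) (insert ((R + 1 : ℕ) : ℤ) (Finset.Icc (-(R : ℤ)) R)) := by
      ext k
      simp only [Finset.mem_Icc, Finset.mem_insert]
      omega
    rw [h, Finset.sum_insert (by simp only [Finset.mem_Icc, Finset.mem_insert]; omega),
      Finset.sum_insert (by simp only [Finset.mem_Icc]; omega), Int.natAbs_neg,
      Int.natAbs_natCast, pow_succ]
    linarith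

/-- Each net point has Gaussian weight e^{-|k|²} ≥ e^{-16n}, while the total weight over the box
factors into n sums, each at most 3 ≤ e². -/
theorem card_latticeNet_le (n : ℕ) : ((latticeNet n).card : ℝ) ≤ Real.exp (18 * n) := by
  have hterm : ∀ k : ℤ, Real.exp (-((k : ℝ) ^ 2)) ≤ (1 / 2 : ℝ) ^ k.natAbs := by
    intro k
    have h1 : (k.natAbs : ℝ) ≤ (k : ℝ) ^ 2 := by
      have h := Nat.le_self_pow two_ne_zero k.natAbs
      have h' : ((k.natAbs ^ 2 : ℕ) : ℤ) = k ^ 2 := by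
        rw [Nat.cast_pow, Int.natAbs_sq]
      have h2 : (k.natAbs : ℤ) ≤ k ^ 2 := h' ▸ Int.ofNat_le.2 h
      have h3 : (((k.natAbs : ℕ) : ℤ) : ℝ) ≤ ((k ^ 2 : ℤ) : ℝ) := Int.cast_le.2 h2
      rw [Int.cast_pow] at h3
      exact h3
    calc Real.exp (-((k : ℝ) ^ 2)) ≤ Real.exp (-(k.natAbs : ℝ)) :=
          Real.exp_le_exp.2 (neg_le_neg h1)
      _ = Real.exp (-1) ^ k.natAbs := by rw [← Real.exp_nat_mul]; ring_nf
      _ ≤ (1 / 2 : ℝ) ^ k.natAbs := by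
          gcongr
          rw [Real.exp_neg, one_div]
          exact inv_anti₀ two_pos (by linarith [Real.add_one_le_exp (1 : ℝ)])
  have hone : ∑ k ∈ Finset.Icc (-(16 * n : ℤ)) (16 * n), Real.exp (-((k : ℝ) ^ 2)) ≤
      Real.exp 2 := by
    calc _ ≤ ∑ k ∈ Finset.Icc (-(16 * n : ℤ)) (16 * n), (1 / 2 : ℝ) ^ k.natAbs :=
          Finset.sum_le_sum fun k _ => hterm k
      _ ≤ 3 := by
          have h := sum_half_pow_natAbs_le (16 * n)
          push_cast at h
          have : (0 : ℝ) < (1 / 2) ^ (16 * n) := by positivity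
          linarith
      _ ≤ Real.exp 2 := by linarith [Real.add_one_le_exp (2 : ℝ)]
  have hsum : ((latticeNet n).card : ℝ) * Real.exp (-(16 * n)) ≤ Real.exp (2 * n) := by
    calc _ = ∑ k ∈ latticeNet n, Real.exp (-(16 * n)) := by
          rw [Finset.sum_const, nsmul_eq_mul]
      _ ≤ ∑ k ∈ latticeNet n, ∏ i, Real.exp (-((k i : ℝ) ^ 2)) := by
          refine Finset.sum_le_sum fun k hk => ?_
          rw [← Real.exp_sum, Finset.sum_neg_distrib]
          refine Real.exp_le_exp.2 (neg_le_neg ?_)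
          exact_mod_cast mem_latticeNet.1 hk
      _ ≤ ∑ k ∈ Fintype.piFinset fun _ : Fin n => Finset.Icc (-(16 * n : ℤ)) (16 * n),
          ∏ i, Real.exp (-((k i : ℝ) ^ 2)) :=
          Finset.sum_le_sum_of_subset_of_nonneg (Finset.filter_subset _ _) fun k _ _ =>
            Finset.prod_nonneg fun i _ => (Real.exp_pos _).le
      _ = ∏ _i : Fin n, ∑ k ∈ Finset.Icc (-(16 * n : ℤ)) (16 * n), Real.exp (-((k : ℝ) ^ 2)) :=
          (Finset.prod_univ_sum (fun _ : Fin n => Finset.Icc (-(16 * n : ℤ)) (16 * n))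
            fun _ k => Real.exp (-((k : ℝ) ^ 2))).symm
      _ ≤ ∏ _i : Fin n, Real.exp 2 :=
          Finset.prod_le_prod (fun i _ => Finset.sum_nonneg fun k _ => (Real.exp_pos _).le)
            fun i _ => hone
      _ = Real.exp (2 * n) := by
          rw [Finset.prod_const, Finset.card_univ, Fintype.card_fin, ← Real.exp_nat_mul, mul_comm]
  have h16 : Real.exp (-(16 * n : ℝ)) * Real.exp (16 * n) = 1 := by
    rw [← Real.exp_add]; simp
  calc ((latticeNet n).card : ℝ) =
        (latticeNet n).card * Real.exp (-(16 * n)) * Real.exp (16 * n) := by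
        rw [mul_assoc, h16, mul_one]
    _ ≤ Real.exp (2 * n) * Real.exp (16 * n) := by gcongr
    _ = Real.exp (18 * n) := by rw [← Real.exp_add]; ring_nf

/-- The point of the unit ball represented by an integer vector. -/
noncomputable def latticePoint (k : Fin n → ℤ) (i : Fin n) : ℝ := k i / (4 * √n)

theorem sum_sq_latticePoint_le (hn : 1 ≤ n) {k : Fin n → ℤ} (hk : k ∈ latticeNet n) :
    ∑ i, latticePoint k i ^ 2 ≤ 1 := by
  have hn0 : (0 : ℝ) < n := by exact_mod_cast hn
  have h1 : ∑ i, (k i : ℝ) ^ 2 ≤ 16 * n := by exact_mod_cast mem_latticeNet.1 hk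
  have h2 : (4 * √(n : ℝ)) ^ 2 = 16 * n := by
    rw [mul_pow, Real.sq_sqrt hn0.le]; norm_num
  simp only [latticePoint, div_pow, h2]
  rw [← Finset.sum_div, div_le_one (by positivity)]
  exact h1

/-- Rounding towards zero does not increase the norm, so the rounded vector stays in the ball. -/
theorem exists_int_toward_zero (z : ℝ) : ∃ k : ℤ, |(k : ℝ)| ≤ |z| ∧ |z - k| ≤ 1 := by
  rcases le_total 0 z with h | h
  · refine ⟨⌊z⌋, ?_, ?_⟩
    · rw [abs_of_nonneg h, abs_of_nonneg (by exact_mod_cast Int.floor_nonneg.2 h)]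
      exact Int.floor_le z
    · rw [abs_le]
      constructor <;> linarith [Int.floor_le z, Int.lt_floor_add_one z]
  · refine ⟨⌈z⌉, ?_, ?_⟩
    · rw [abs_of_nonpos h,
        abs_of_nonpos (by exact_mod_cast Int.ceil_le.2 (by simpa using h))]
      linarith [Int.le_ceil z]
    · rw [abs_le]
      constructor <;> linarith [Int.le_ceil z, Int.ceil_lt_add_one z]

theorem exists_latticePoint_near (hn : 1 ≤ n) {x : Fin n → ℝ} (hx : ∑ i, x i ^ 2 ≤ 1) :
    ∃ k ∈ latticeNet n, ∑ i, (x i - latticePoint k i) ^ 2 ≤ (1 / 4) ^ 2 := by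
  have hn0 : (0 : ℝ) < n := by exact_mod_cast hn
  have hs : 0 < √(n : ℝ) := Real.sqrt_pos.2 hn0
  have hs2 : √(n : ℝ) ^ 2 = n := Real.sq_sqrt hn0.le
  choose k hk1 hk2 using fun i => exists_int_toward_zero (x i * (4 * √n))
  refine ⟨k, mem_latticeNet.2 ?_, ?_⟩
  · have h : ∑ i, (k i : ℝ) ^ 2 ≤ 16 * n := by
      calc ∑ i, (k i : ℝ) ^ 2 ≤ ∑ i, (x i * (4 * √n)) ^ 2 :=
            Finset.sum_le_sum fun i _ => sq_le_sq.2 (hk1 i)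
        _ = 16 * n * ∑ i, x i ^ 2 := by
            rw [Finset.mul_sum]
            refine Finset.sum_congr rfl fun i _ => ?_
            rw [mul_pow, mul_pow, hs2]
            ring
        _ ≤ 16 * n * 1 := by gcongr
        _ = _ := mul_one _
    exact_mod_cast h
  · calc _ ≤ ∑ _i : Fin n, (1 / (4 * √(n : ℝ))) ^ 2 := by
          refine Finset.sum_le_sum fun i _ => ?_
          have h : x i - latticePoint k i = (x i * (4 * √n) - k i) / (4 * √n) := by
            rw [latticePoint]; field_simp
          rw [h, div_pow, div_pow]
          refine div_le_div_of_nonneg_right ?_ (sq_nonneg _)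
          rw [one_pow]
          exact (sq_le_one_iff_abs_le_one _).2 (hk2 i)
      _ = (1 / 4) ^ 2 := by
          rw [Finset.sum_const, Finset.card_univ, Fintype.card_fin, nsmul_eq_mul, div_pow,
            mul_pow, hs2]
          field_simp

open scoped RealInnerProductSpace in
/-- The spectral norm of a symmetric matrix is at most twice the supremum of its quadratic form
over the lattice net. -/
theorem matrixSpectralNorm_le_of_net (hn : 1 ≤ n) {M : Matrix (Fin n) (Fin n) ℝ}
    (hM : M.IsHermitian) {B : ℝ}
    (hB : ∀ k ∈ latticeNet n, |∑ i, ∑ j, latticePoint k i * latticePoint k j * M i j| ≤ B) :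
    matrixSpectralNorm M ≤ 2 * B := by
  rw [matrixSpectralNorm]
  set T := Matrix.toEuclideanCLM (n := Fin n) (𝕜 := ℝ) M with hT
  have hsymm : T.IsSymmetric := Matrix.isSymmetric_toEuclideanLin_iff.2 hM
  have hunit : ∀ x : EuclideanSpace ℝ (Fin n), ‖x‖ = 1 → |⟪T x, x⟫| ≤ B + ‖T‖ / 2 := by
    intro x hx
    have hx2 : ∑ i, x i ^ 2 ≤ 1 := by
      rw [← EuclideanSpace.real_norm_sq_eq, hx]; norm_num
    obtain ⟨k, hk, hxk⟩ := exists_latticePoint_near hn hx2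
    set y : EuclideanSpace ℝ (Fin n) := WithLp.toLp 2 (latticePoint k) with hy
    have hy1 : ‖y‖ ≤ 1 := by
      rw [← sq_le_one_iff₀ (norm_nonneg _), EuclideanSpace.real_norm_sq_eq]
      exact sum_sq_latticePoint_le hn hk
    have hxy : ‖x - y‖ ≤ 1 / 4 := by
      rw [← sq_le_sq₀ (norm_nonneg _) (by norm_num), EuclideanSpace.real_norm_sq_eq]
      exact hxk
    have hxy2 : ‖x + y‖ ≤ 2 := (norm_add_le x y).trans (by linarith)
    have hQ : |⟪T y, y⟫| ≤ B := by
      refine le_trans (le_of_eq ?_) (hB k hk)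
      rw [real_inner_comm, hT, Matrix.inner_toEuclideanCLM, dotProduct]
      congr 1
      refine Finset.sum_congr rfl fun i _ => ?_
      rw [Matrix.mulVec, dotProduct, Finset.mul_sum]
      exact Finset.sum_congr rfl fun j _ => by simp only [hy]; ring
    -- Symmetry of T cancels the cross terms; the factors 1/4 and 2 then leave half of ‖T‖, which is
    -- absorbed at the end.
    have hsub : ⟪T x, x⟫ - ⟪T y, y⟫ = ⟪T (x - y), x + y⟫ := by
      have h : ⟪T x, y⟫ = ⟪T y, x⟫ := (hsymm x y).trans (real_inner_comm _ _)
      rw [map_sub, inner_sub_left, inner_add_right, inner_add_right, h]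
      ring
    have hdiff : |⟪T (x - y), x + y⟫| ≤ ‖T‖ / 2 := by
      calc |⟪T (x - y), x + y⟫| ≤ ‖T (x - y)‖ * ‖x + y‖ := abs_real_inner_le_norm _ _
        _ ≤ (‖T‖ * ‖x - y‖) * ‖x + y‖ := by gcongr; exact T.le_opNorm _
        _ ≤ (‖T‖ * (1 / 4)) * 2 := by gcongr
        _ = ‖T‖ / 2 := by ring
    calc |⟪T x, x⟫| = |⟪T y, y⟫ + ⟪T (x - y), x + y⟫| := by rw [← hsub]; ring_nf
      _ ≤ _ := (abs_add_le _ _).trans (add_le_add hQ hdiff)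
  have hB0 : 0 ≤ B := (abs_nonneg _).trans (hB 0 (mem_latticeNet.2 (by simp)))
  have hle : ‖T‖ ≤ B + ‖T‖ / 2 := by
    conv_lhs => rw [ContinuousLinearMap.norm_eq_iSup_rayleighQuotient T hsymm]
    refine ciSup_le fun x => ?_
    rcases eq_or_ne x 0 with rfl | hx
    · simpa using add_nonneg hB0 (by positivity : 0 ≤ ‖T‖ / 2)
    have hx0 : ‖x‖ ≠ 0 := norm_ne_zero_iff.2 hx
    have hnorm : ‖‖x‖⁻¹ • x‖ = 1 := by rw [norm_smul, norm_inv, norm_norm, inv_mul_cancel₀ hx0]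
    rw [← T.rayleigh_smul x (inv_ne_zero hx0), ContinuousLinearMap.rayleighQuotient, hnorm,
      one_pow, div_one]
    exact hunit _ hnorm
  linarith

end Net

/-! ### Splitting the quadratic form into light and heavy parts. -/

section Deterministic

variable {n d : ℕ}

theorem similarityMatrix_symm (w : Edge n d → ℝ) (i j : Fin n) :
    similarityMatrix w i j = similarityMatrix w j i := by
  simp only [similarityMatrix, Matrix.of_apply, eq_comm (a := i), and_comm (a := i ∈ _)]

theorem similarityMatrix_nonneg {w : Edge n d → ℝ} (hw : ∀ e, 0 ≤ w e) (i j : Fin n) :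
    0 ≤ similarityMatrix w i j := by
  simp only [similarityMatrix, Matrix.of_apply]
  split_ifs
  · exact le_rfl
  · refine Finset.sum_nonneg fun e _ => ?_
    split_ifs
    · exact hw e
    · exact le_rfl

theorem similarityMatrix_le {w : Edge n d → ℝ} {μ : ℝ} (hμ : 0 ≤ μ) (hw : ∀ e, w e ≤ μ)
    (i j : Fin n) : similarityMatrix w i j ≤ ((n - 2).choose (d - 2) : ℝ) * μ := by
  simp only [similarityMatrix, Matrix.of_apply]
  split_ifs with hij
  · positivity
  · rw [← Finset.sum_filter]
    calc _ ≤ ∑ e : Edge n d with i ∈ e.1 ∧ j ∈ e.1, μ := Finset.sum_le_sum fun e _ => hw e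
      _ = ((Finset.univ.filter fun e : Edge n d => i ∈ e.1 ∧ j ∈ e.1).card : ℝ) * μ := by
          rw [Finset.sum_const, nsmul_eq_mul]
      _ ≤ _ := by
          gcongr
          exact card_edges_containing_pair_le hij

theorem sum_sum_sq_mul_sq_le {y : Fin n → ℝ} (hy : ∑ i, y i ^ 2 ≤ 1) :
    ∑ i, ∑ j, y i ^ 2 * y j ^ 2 ≤ 1 := by
  rw [← Finset.sum_mul_sum]
  exact mul_le_one₀ hy (Finset.sum_nonneg fun i _ => sq_nonneg _) hy

/-- The coefficients of the quadratic form at `y` that do not exceed `v` in absolute value. -/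
noncomputable def lightCoeff (v : ℝ) (y : Fin n → ℝ) (i j : Fin n) : ℝ :=
  if |y i| * |y j| ≤ v then y i * y j else 0

theorem abs_lightCoeff_le {v : ℝ} (hv : 0 ≤ v) (y : Fin n → ℝ) (i j : Fin n) :
    |lightCoeff v y i j| ≤ v := by
  rw [lightCoeff]
  split_ifs with h
  · rwa [abs_mul]
  · simpa using hv

theorem sum_sq_lightCoeff_le (v : ℝ) {y : Fin n → ℝ} (hy : ∑ i, y i ^ 2 ≤ 1) :
    ∑ i, ∑ j, lightCoeff v y i j ^ 2 ≤ 1 := by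
  refine le_trans ?_ (sum_sum_sq_mul_sq_le hy)
  gcongr with i _ j _
  rw [lightCoeff]
  split_ifs
  · rw [mul_pow]
  · rw [zero_pow two_ne_zero]
    exact mul_nonneg (sq_nonneg _) (sq_nonneg _)

/-- A quadratic form is bounded by its light part, and by the heavy parts of the two matrices. -/
theorem abs_quadraticForm_sub_le {w : ℝ} (hw : 0 < w) (hn : 1 ≤ n)
    {A E : Matrix (Fin n) (Fin n) ℝ} (hA : ∀ i j, 0 ≤ A i j) (hE : ∀ i j, 0 ≤ E i j)
    (hE2 : ∀ i j, E i j ≤ w ^ 2 / n) {y : Fin n → ℝ} (hy : ∑ i, y i ^ 2 ≤ 1) {b c : ℝ}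
    (hlight : |∑ i, ∑ j, lightCoeff (w / n) y i j * (A - E) i j| ≤ b)
    (hheavy : ∑ i, ∑ j, (if w / n < |y i| * |y j| then |y i| * |y j| else 0) * A i j ≤ c) :
    |∑ i, ∑ j, y i * y j * (A - E) i j| ≤ b + c + w := by
  have hn0 : (0 : ℝ) < n := by exact_mod_cast hn
  set g : Fin n → Fin n → ℝ := fun i j => if w / n < |y i| * |y j| then |y i| * |y j| else 0
  have hg : ∀ i j, g i j = if w / n < |y i| * |y j| then |y i| * |y j| else 0 := fun _ _ => rfl
  have hpt : ∀ i j, |y i * y j * (A - E) i j - lightCoeff (w / n) y i j * (A - E) i j| ≤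
      g i j * A i j + g i j * E i j := by
    intro i j
    rw [hg, lightCoeff]
    by_cases h : |y i| * |y j| ≤ w / n
    · simp [h, not_lt.2 h]
    · rw [if_neg h, if_pos (not_le.1 h), zero_mul, sub_zero, abs_mul, abs_mul, ← mul_add]
      gcongr
      rw [Matrix.sub_apply, abs_le]
      constructor <;> linarith [hA i j, hE i j]
  -- On heavy pairs |y_i y_j| ≤ (n/w) y_i² y_j², which offsets the entry bound w²/n.
  have hgE : ∑ i, ∑ j, g i j * E i j ≤ w := by
    calc _ ≤ ∑ i, ∑ j, w * (y i ^ 2 * y j ^ 2) := by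
          refine Finset.sum_le_sum fun i _ => Finset.sum_le_sum fun j _ => ?_
          rw [hg]
          split_ifs with h
          · have h1 : |y i| * |y j| * (w / n) ≤ y i ^ 2 * y j ^ 2 := by
              calc _ ≤ |y i| * |y j| * (|y i| * |y j|) := by gcongr
                _ = _ := by rw [← sq_abs (y i), ← sq_abs (y j)]; ring
            calc |y i| * |y j| * E i j ≤ |y i| * |y j| * (w ^ 2 / n) := by
                  gcongr
                  exact hE2 i j
              _ = w * (|y i| * |y j| * (w / n)) := by ring
              _ ≤ _ := by gcongr
          · rw [zero_mul]
            positivity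
      _ = w * ∑ i, ∑ j, y i ^ 2 * y j ^ 2 := by simp only [Finset.mul_sum]
      _ ≤ w * 1 := by
          gcongr
          exact sum_sum_sq_mul_sq_le hy
      _ = w := mul_one w
  have hdiff : |∑ i, ∑ j, y i * y j * (A - E) i j -
      ∑ i, ∑ j, lightCoeff (w / n) y i j * (A - E) i j| ≤ c + w := by
    rw [← Finset.sum_sub_distrib]
    calc _ ≤ ∑ i, ∑ j, (g i j * A i j + g i j * E i j) := by
          refine (Finset.abs_sum_le_sum_abs _ _).trans (Finset.sum_le_sum fun i _ => ?_)
          rw [← Finset.sum_sub_distrib]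
          exact (Finset.abs_sum_le_sum_abs _ _).trans (Finset.sum_le_sum fun j _ => hpt i j)
      _ = ∑ i, ∑ j, g i j * A i j + ∑ i, ∑ j, g i j * E i j := by
          simp only [Finset.sum_add_distrib]
      _ ≤ _ := add_le_add hheavy hgE
  have h1 := abs_le.1 hlight
  have h2 := abs_le.1 hdiff
  rw [abs_le]
  constructor <;> linarith [h1.1, h1.2, h2.1, h2.2]

end Deterministic

/-! ### Assembly of the events and the final bound. -/

/-- Concentration of the similarity matrix around its mean, with an explicit constant. -/
theorem measureReal_spectralNorm_le {n d : ℕ} (hd : 2 ≤ d) (hn : 2 ≤ n) {α : ℝ} (hα : 0 < α)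
    {Ω : Type*} [MeasurableSpace Ω] {P : Measure Ω} [IsProbabilityMeasure P]
    {W : Edge n d → Ω → ℝ} {μ D : ℝ} (hW : ∀ e, Measurable (W e))
    (h01 : ∀ e, ∀ᵐ ω ∂P, W e ω ∈ Set.Icc (0 : ℝ) 1) (hind : iIndepFun W P)
    (hμ0 : 0 ≤ μ) (hμ : ∀ e, ∫ ω, W e ω ∂P ≤ μ)
    (hD : D = n * ((n - 2).choose (d - 2) : ℝ) * μ) (hlog : α * Real.log n ≤ D) :
    1 - 4 * ((n : ℝ) ^ 11)⁻¹ ≤ P.real {ω | matrixSpectralNorm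
      ((similarityMatrix fun e => W e ω) - similarityMatrix fun e => ∫ ω', W e ω' ∂P) ≤
        2 * (30 * d ^ 2 + (32 * (3 + 12 * d ^ 2 / α) + 384 + 384 * (14 * d ^ 2)) + 1) * √D} := by
  classical
  have hn1 : 1 ≤ n := by omega
  have hn0 : (0 : ℝ) < n := by exact_mod_cast hn1
  have hlogn : 0 < Real.log n := Real.log_pos (by exact_mod_cast hn)
  have hD0 : 0 < D := (mul_pos hα hlogn).trans_le hlog
  set w := √D with hwdef
  have hw : 0 < w := Real.sqrt_pos.2 hD0
  have hw2 : w ^ 2 = D := Real.sq_sqrt hD0.le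
  obtain ⟨L, hL⟩ : ∃ L : ℕ, 2 * (1 / 2 : ℝ) ^ L ≤ w / n := by
    obtain ⟨L, hL⟩ := exists_pow_lt_of_lt_one (show 0 < w / n / 2 by positivity)
      (by norm_num : (1 / 2 : ℝ) < 1)
    exact ⟨L, by linarith⟩
  set r : ℕ × ℕ → ℝ := fun p => 4 * ((1 / 2 : ℝ) ^ p.1 * (1 / 2) ^ p.2) * n / w with hr
  -- Exactly the exponents that `heavy_sum_le` calls for; they depend neither on ω nor on the net
  -- point.
  set Λ : Finset ℝ := ((Finset.range L ×ˢ Finset.range L).filter fun p => 1 ≤ r p).image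
    fun p => 1 + Real.log (r p) with hΛdef
  have hΛ : ∀ l ∈ Λ, 0 < l := by
    intro l hl
    obtain ⟨p, hp, rfl⟩ := Finset.mem_image.1 hl
    have := Real.log_nonneg (Finset.mem_filter.1 hp).2
    linarith
  set A : Ω → Matrix (Fin n) (Fin n) ℝ := fun ω => similarityMatrix fun e => W e ω with hAdef
  set E : Matrix (Fin n) (Fin n) ℝ := similarityMatrix fun e => ∫ ω', W e ω' ∂P with hEdef
  set B₀ : Set Ω := {ω | ¬ ∀ e, W e ω ∈ Set.Icc (0 : ℝ) 1} with hB₀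
  set B₁ : Set Ω := {ω | ∃ i : Fin n, Real.exp 1 * D + d ^ 2 * (12 * Real.log n) ≤
    crossSum (A ω) {i} Finset.univ} with hB₁
  set B₂ : Set Ω := {ω | ∃ S T : Finset (Fin n), S ⊆ T ∧ T.Nonempty ∧ ∃ l ∈ Λ,
    Real.exp l * (S.card * T.card) * (D / n) + d ^ 2 * (14 * setEntropy n T.card) / l ≤
      crossSum (A ω) S T} with hB₂
  set B₃ : (Fin n → ℤ) → Set Ω := fun k => {ω | 30 * d ^ 2 * w ≤
    ∑ i, ∑ j, lightCoeff (w / n) (latticePoint k) i j * (A ω - E) i j} with hB₃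
  set B₄ : (Fin n → ℤ) → Set Ω := fun k => {ω | 30 * d ^ 2 * w ≤
    ∑ i, ∑ j, -lightCoeff (w / n) (latticePoint k) i j * (A ω - E) i j} with hB₄
  -- The weights lie in the unit interval only almost surely, whereas the heavy bound needs
  -- nonnegative entries pointwise.
  have hP₀ : P.real B₀ = 0 := by
    rw [measureReal_eq_zero_iff]
    exact ae_all_iff.2 h01
  have hP₁ : P.real B₁ ≤ ((n : ℝ) ^ 11)⁻¹ :=
    measureReal_degree hd hn1 hW h01 hind hμ0 hμ hD
  have hP₂ : P.real B₂ ≤ ((n : ℝ) ^ 11)⁻¹ :=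
    measureReal_discrepancy hd hn1 hW h01 hind hμ0 hμ hD hΛ
  have hP₃ : ∀ k ∈ latticeNet n, P.real (B₃ k ∪ B₄ k) ≤ 2 * Real.exp (-(29 * n)) := by
    intro k hk
    have hl := abs_lightCoeff_le (div_pos hw hn0).le (latticePoint k)
    have hl2 := sum_sq_lightCoeff_le (w / n) (sum_sq_latticePoint_le hn1 hk)
    have h3 : P.real (B₃ k) ≤ Real.exp (-(29 * n)) :=
      measureReal_light hd hn1 hW h01 hind hμ0 hμ hD hD0 hl hl2
    have h4 : P.real (B₄ k) ≤ Real.exp (-(29 * n)) :=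
      measureReal_light hd hn1 hW h01 hind hμ0 hμ hD hD0
        (f := fun i j => -lightCoeff (w / n) (latticePoint k) i j)
        (fun i j => by rw [abs_neg]; exact hl i j) (by simpa only [neg_sq] using hl2)
    linarith [measureReal_union_le (μ := P) (B₃ k) (B₄ k)]
  have hP₄ : P.real (⋃ k ∈ latticeNet n, (B₃ k ∪ B₄ k)) ≤ 2 * ((n : ℝ) ^ 11)⁻¹ := by
    calc _ ≤ ∑ k ∈ latticeNet n, 2 * Real.exp (-(29 * n)) :=
          (measureReal_biUnion_finset_le _ _).trans (Finset.sum_le_sum hP₃)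
      _ = (latticeNet n).card * (2 * Real.exp (-(29 * n))) := by
          rw [Finset.sum_const, nsmul_eq_mul]
      -- The net costs 18n of the exponent 29n, and the remaining 11n is at least 11 log n.
      _ ≤ Real.exp (18 * n) * (2 * Real.exp (-(29 * n))) := by
          gcongr
          exact card_latticeNet_le n
      _ = 2 * Real.exp (-(11 * n)) := by
          rw [mul_left_comm, ← Real.exp_add]
          ring_nf
      _ ≤ 2 * Real.exp (-(11 * Real.log n)) := by
          gcongr
          exact Real.log_le_self hn0.le
      _ = _ := by
          have := exp_neg_mul_log hn1 11
          push_cast at this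
          rw [this]
  set G : Set Ω := {ω | matrixSpectralNorm (A ω - E) ≤
    2 * (30 * d ^ 2 + (32 * (3 + 12 * d ^ 2 / α) + 384 + 384 * (14 * d ^ 2)) + 1) * w} with hG
  have hsub : Set.univ ⊆ G ∪ (B₀ ∪ B₁ ∪ B₂ ∪ ⋃ k ∈ latticeNet n, (B₃ k ∪ B₄ k)) := by
    intro ω _
    by_contra hω
    simp only [Set.mem_union, Set.mem_iUnion, not_or, not_exists] at hω
    obtain ⟨hωG, ⟨⟨hω0, hω1⟩, hω2⟩, hω3⟩ := hω
    refine hωG ?_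
    have hW01 : ∀ e, W e ω ∈ Set.Icc (0 : ℝ) 1 := not_not.1 hω0
    have hA0 : ∀ i j, 0 ≤ A ω i j := similarityMatrix_nonneg fun e => (hW01 e).1
    have hE0 : ∀ i j, 0 ≤ E i j := similarityMatrix_nonneg fun e =>
      integral_nonneg_of_ae (by filter_upwards [h01 e] with ω hω using hω.1)
    have hE1 : ∀ i j, E i j ≤ w ^ 2 / n := fun i j => by
      refine (similarityMatrix_le hμ0 hμ i j).trans (le_of_eq ?_)
      rw [hw2, hD]
      field_simp
    have hherm : (A ω - E).IsHermitian := by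
      ext i j
      simp only [Matrix.conjTranspose_apply, Matrix.sub_apply, star_trivial, hAdef, hEdef]
      rw [similarityMatrix_symm _ j i, similarityMatrix_symm _ j i]
    have hdeg : ∀ i, crossSum (A ω) {i} Finset.univ ≤ (3 + 12 * d ^ 2 / α) * w ^ 2 := by
      intro i
      have h1 : crossSum (A ω) {i} Finset.univ < Real.exp 1 * D + d ^ 2 * (12 * Real.log n) :=
        lt_of_not_ge fun h => hω1 ⟨i, h⟩
      -- This absorbs the logarithmic term of the degree bound and is how α enters the constant.
      have h2 : Real.log n ≤ D / α := by
        rw [le_div_iff₀ hα]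
        linarith
      have h3 : (d : ℝ) ^ 2 * (12 * Real.log n) ≤ d ^ 2 * (12 * (D / α)) := by gcongr
      have h4 : Real.exp 1 * D ≤ 3 * D := by
        gcongr
        linarith [Real.exp_one_lt_d9]
      rw [hw2, add_mul]
      have h5 : 12 * (d : ℝ) ^ 2 / α * D = d ^ 2 * (12 * (D / α)) := by ring
      linarith
    have hheavy : ∀ k ∈ latticeNet n,
        ∑ i, ∑ j, (if w / n < |latticePoint k i| * |latticePoint k j| then
          |latticePoint k i| * |latticePoint k j| else 0) * A ω i j ≤
          (32 * (3 + 12 * d ^ 2 / α) + 384 + 384 * (14 * d ^ 2)) * w := by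
      intro k hk
      refine heavy_sum_le hn1 hw hA0 (similarityMatrix_symm _) (by positivity) (by positivity)
        hdeg hL ?_ (x := fun i => |latticePoint k i|) (fun i => abs_nonneg _)
        (by simpa only [sq_abs] using sum_sq_latticePoint_le hn1 hk)
      intro S T hST hT a ha b hb hab
      have hmem : 1 + Real.log (r (a, b)) ∈ Λ := Finset.mem_image_of_mem _ <|
        Finset.mem_filter.2 ⟨Finset.mk_mem_product (Finset.mem_range.2 ha) (Finset.mem_range.2 hb),
          hab⟩
      have h := lt_of_not_ge fun h => hω2 ⟨S, T, hST, hT, _, hmem, h⟩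
      refine h.le.trans (le_of_eq ?_)
      rw [hw2]
      simp only [hr]
      ring
    have hnet := matrixSpectralNorm_le_of_net hn1 hherm
      (B := 30 * d ^ 2 * w + (32 * (3 + 12 * d ^ 2 / α) + 384 + 384 * (14 * d ^ 2)) * w + w)
      fun k hk => by
        refine abs_quadraticForm_sub_le hw hn1 hA0 hE0 hE1 (sum_sq_latticePoint_le hn1 hk) ?_
          (hheavy k hk)
        have h3 : _ < 30 * d ^ 2 * w := lt_of_not_ge fun h => (hω3 k hk).1 h
        have h4 : _ < 30 * d ^ 2 * w := lt_of_not_ge fun h => (hω3 k hk).2 h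
        simp only [neg_mul, Finset.sum_neg_distrib] at h4
        rw [abs_le]
        constructor <;> linarith
    refine hnet.trans (le_of_eq ?_)
    ring
  -- Covering the whole space and using subadditivity avoids any measurability of the norm event.
  have hcover := measureReal_mono hsub (measure_ne_top P _)
  rw [probReal_univ] at hcover
  have hu := measureReal_union_le (μ := P) G
    (B₀ ∪ B₁ ∪ B₂ ∪ ⋃ k ∈ latticeNet n, (B₃ k ∪ B₄ k))
  have hu1 := measureReal_union_le (μ := P) (B₀ ∪ B₁ ∪ B₂) (⋃ k ∈ latticeNet n, (B₃ k ∪ B₄ k))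
  have hu2 := measureReal_union_le (μ := P) (B₀ ∪ B₁) B₂
  have hu3 := measureReal_union_le (μ := P) B₀ B₁
  linarith

end RandomHypergraph

theorem theorem7p1 (d : ℕ) (hd : 2 ≤ d) (α : ℝ) (hα : 0 < α) :
    ∃ c₅ : ℝ, 0 < c₅ ∧
      ∀ (n : ℕ), 1 ≤ n →
      ∀ (Ω : Type*) [MeasurableSpace Ω] (P : Measure Ω) [IsProbabilityMeasure P]
        (W : RandomHypergraph.Edge n d → Ω → ℝ) (μ : ℝ),
        (∀ e, Measurable (W e)) →
        (∀ e, ∀ᵐ ω ∂P, W e ω ∈ Set.Icc (0 : ℝ) 1) →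
        iIndepFun W P →
        0 < μ →
        (∀ e, ∫ ω, W e ω ∂P ≤ μ) →
        α * Real.log n ≤ n * ((n - 2).choose (d - 2) : ℝ) * μ →
        1 - 4 * (n : ℝ) ^ (-11 : ℤ) ≤
          P.real {ω | RandomHypergraph.matrixSpectralNorm
              (RandomHypergraph.similarityMatrix (fun e => W e ω) -
                RandomHypergraph.expectedMatrix P
                  (fun ω' => RandomHypergraph.similarityMatrix (fun e => W e ω'))) ≤
            c₅ * Real.sqrt (n * ((n - 2).choose (d - 2) : ℝ) * μ)} := by
  refine ⟨2 * (30 * d ^ 2 + (32 * (3 + 12 * d ^ 2 / α) + 384 + 384 * (14 * d ^ 2)) + 1),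
    by positivity, ?_⟩
  intro n hn Ω _ P _ W μ hW h01 hind hμ0 hμ hlog
  have hpow : (n : ℝ) ^ (-11 : ℤ) = ((n : ℝ) ^ 11)⁻¹ := by
    rw [zpow_neg]
    norm_cast
  rw [hpow, RandomHypergraph.expectedMatrix_similarityMatrix hW h01]
  rcases hn.eq_or_lt with rfl | hn2
  -- For n = 1 the left side is -3; this case is separate because log 1 = 0 does not force D > 0.
  · refine le_trans ?_ measureReal_nonneg
    norm_num
  · exact RandomHypergraph.measureReal_spectralNorm_le hd hn2 hα hW h01 hind hμ0.le hμ rfl hlog
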